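/- **Language.** Sensitivities are elements of $[0,\infty]$ (with $0\cdot\infty=0$); a gradual sensitivity is an interval $[s_1,s_2]$, $s_1\le s_2$; we write $s$ for $[s,s]$ and $?$ for $[0,\infty]$; sums and products are endpointwise. A sensitivity environment $\Xi$ is a formal sum $\sum_i \varsigma_i r_i$ of gradual sensitivities over the finitely many distance variables in scope; substitution of environments for distance variables is linear. Types are $g::=B\mid G\to G\mid \forall r.G$ and $G::=g_\Xi$, where the base types $B$ are the reals $\mathbb R$, the booleans, and a type of data with carrier an arbitrary extended pseudometric space $D$; $g_{\Xi}+\Xi'$ means $g_{\Xi+\Xi'}$. Distances $d_B$ on base types are $|x-y|$, the discrete distance, and the distance of $D$. Source expressions are $$e::=c\mid \mathrm{op}\,\bar e\mid x\mid \lambda x{:}G.e\mid e\,e\mid \Lambda r.e\mid e[\Xi]\mid e::G ,$$ where a primitive operation is a total function on constants with declared sensitivities $s_j$ such that $d(\mathrm{op}(\bar x),\mathrm{op}(\bar y))\le\sum_j s_j\,d(x_j,y_j)$, and $\mathrm{op}$ applied to arguments of types $(B_j)_{\Xi_j}$ has effect $\sum_j s_j\Xi_j$ (for example $+$ with sensitivities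 $1,1$; multiplication and $\le$ with $\infty,\infty$). Evidence is a pair of types. The interior of $[s_1,s_2]\lesssim[s_3,s_4]$ is $\langle[s_1,s_2\wedge s_4],[s_1\vee s_3,s_4]\rangle$, and consistent transitivity is $$\langle[s_{11},s_{12}],[s_{13},s_{14}]\rangle\circ\langle[s_{21},s_{22}],[s_{23},s_{24}]\rangle=\langle[s_{11},s_{12}\wedge s_{14}\wedge s_{22}],[s_{13}\vee s_{21}\vee s_{23},s_{24}]\rangle ,$$ both undefined if a resulting pair of endpoints is not an interval; both are lifted structurally to types, contravariantly in domains. A well-typed source expression is elaborated to an internal expression in which every introduction form, function argument and ascription carries evidence $\varepsilon\,e::G$, computed as the interior of the consistent subtyping judgment that it needs: introduction forms have effect $0$; $e_1e_2$ has type $\mathrm{cod}$ of the type of $e_1$, with $\mathrm{dom}((G_1\to G_2)_\Xi)=G_1$ and $\mathrm{cod}((G_1\to G_2)_\Xi)=G_2+\Xi$; and $e[\Xi']$ has type $\mathrm{inst}((\forall r.G)_\Xi,\Xi')=G[\Xi'/r]+\Xi$. Values are $v::=\varepsilon u::G$ with $u::=c\mid\lambda x{:}G.e\mid\Lambda r.v$.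 Reduction is left-to-right call by value, also below $\Lambda$, with the rules - $\mathrm{op}\,\overline{(\varepsilon_i c_i::G_i)}\to\delta_{\mathrm{op}}(\bar\varepsilon)\,\mathrm{op}(\bar c)::\delta_{\mathrm{op}}(\bar G)$, where $\delta_{\mathrm{op}}$ computes the result type, componentwise on evidence; - $(\varepsilon(\lambda x{:}G_1'.e)::G)\,(\varepsilon_1u::G_1)\to\mathrm{cod}(\varepsilon)\,\bigl(e[((\varepsilon_1\circ\mathrm{dom}(\varepsilon))\,u::G_1')/x]\bigr)::\mathrm{cod}(G)$; - $(\varepsilon(\Lambda r.v)::G)[\Xi]\to\mathrm{inst}(\varepsilon,\Xi)\,(v[\Xi/r])::\mathrm{inst}(G,\Xi)$; - $\varepsilon(\varepsilon'u::G')::G\to(\varepsilon'\circ\varepsilon)\,u::G$; and with an error when a composition $\circ$ is undefined. **Mechanisms.** Fix a base type $T$, a distance variable $r$ and $\epsilon>0$. A *query* is a value $f$ of some closed well-typed expression of type $(T_{1r}\to\mathbb R_{?r})_{0}$. Let $\mathrm{laplace}(v,s,\epsilon)$ be the Laplace distribution with mean $v$ and scale $s/\epsilon$. The Gradual Laplace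 Mechanism is $$\mathrm{GLM}(c,f,\epsilon)=\mathrm{laplace}\bigl((f(x)::\mathbb R_{1r}),\,1,\,\epsilon\bigr),$$ where $x$ is bound to the value of type $T_{1r}$ holding the constant $c\in T$; its outcome is a noisy number if $f(x)::\mathbb R_{1r}$ evaluates to a number, and an error if that evaluation ends in an error. The Gradual Above Threshold algorithm $\mathrm{GAT}(c,fs,thr,\epsilon)$, for a finite list $fs$ of queries and $thr\in\mathbb R$, draws a noisy threshold $t$ from $\mathrm{laplace}(thr,1,\epsilon/2)$ and then goes through $fs$ in order; for each $f$ it runs $\mathrm{GLM}(c,f,\epsilon/4)$ with fresh noise, skips $f$ if this fails, and returns the (0-based) index of the first $f$ whose noisy result is $\ge t$; it returns $-1$ if there is none. A randomized algorithm $M$ with inputs in $T$ is $\epsilon$-differentially private if $M(c)$ is a probability distribution for every $c$ and $\Pr[M(c)\in S]\le e^{\epsilon}\Pr[M(c')\in S]$ for all $c,c'$ with $d_T(c,c')\le1$ and all measurable sets $S$ of outcomes, where an error is one of the outcomes. **Theorem.** 1. For every query $f$, either $\mathrm{GLM}(c,f,\epsilon)$ fails with an error (with probability $1$) for every input $c\in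 T$, or for every input $c\in T$ it fails with probability $0$, and $c\mapsto\mathrm{GLM}(c,f,\epsilon)$ is $\epsilon$-differentially private. 2. For every finite list $fs$ of queries and every $thr\in\mathbb R$, $c\mapsto\mathrm{GAT}(c,fs,thr,\epsilon)$ is $\epsilon$-differentially private. -/

import Mathlib

open MeasureTheory

/-! ## Gradual sensitivities and sensitivity environments -/

/-- A gradual sensitivity: a nonempty closed interval `[s₁, s₂]` of sensitivities in `[0, ∞]`.
A static sensitivity `s` is `NonemptyInterval.pure s`; sums and products are endpointwise,
with `0 * ∞ = 0`; `1` and `0` are `[1, 1]` and `[0, 0]`. -/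
abbrev Sens := NonemptyInterval ENNReal

/-- The unknown sensitivity `? = [0, ∞]`. -/
def Sens.unknown : Sens := ⟨(0, ⊤), bot_le⟩

/-- A gradual sensitivity environment over the `n` distance variables in scope
(variables that do not occur have sensitivity `0`). -/
abbrev Env (n : ℕ) := Fin n → Sens

/-- The environment `s r`. -/
def Env.single {n : ℕ} (r : Fin n) (s : Sens) : Env n := Pi.single r s

/-- Simultaneous substitution of environments for distance variables:
`(s₁ r₁ + ⋯ + sₘ rₘ)[σ] = s₁ σ(r₁) + ⋯ + sₘ σ(rₘ)`. -/
noncomputable def Env.subst {m n : ℕ} (Ξ : Env m) (σ : Fin m → Env n) : Env n :=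
  fun i => ∑ j, Ξ j * σ j i

/-- Distance variables are de Bruijn indices; variable `0` is the one bound last.
The substitution that renames `r` to `r + 1`. -/
def DSub.shift (n : ℕ) : Fin n → Env (n + 1) := fun j => Env.single j.succ 1

/-- The substitution of `Ξ` for variable `0`. -/
def DSub.inst {n : ℕ} (Ξ : Env n) : Fin (n + 1) → Env n :=
  Fin.cons Ξ (fun j => Env.single j 1)

/-- A substitution carried under a binder. -/
noncomputable def DSub.lift {m n : ℕ} (σ : Fin m → Env n) : Fin (m + 1) → Env (n + 1) :=
  Fin.cons (Env.single 0 1) (fun j => (σ j).subst (DSub.shift n))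

/-- Gather a family of optional values: defined when every member is. -/
noncomputable def optPi {n : ℕ} {α : Type} (f : Fin n → Option α) : Option (Fin n → α) :=
  open Classical in
  if h : ∀ i, (f i).isSome then some (fun i => (f i).get (h i)) else none

/-! ## Types -/

/-- Base types: real numbers, booleans, and one further type of data (databases). -/
inductive Base
  | real
  | bool
  | data
  deriving DecidableEq

/-- Types `g ::= B | g₁_Ξ₁ → g₂_Ξ₂ | ∀ r. g_Ξ` with `n` distance variables in scope. -/
inductive Ty : ℕ → Type
  | base {n : ℕ} (b : Base) : Ty n
  | arr {n : ℕ} (g₁ : Ty n) (Ξ₁ : Env n) (g₂ : Ty n) (Ξ₂ : Env n) : Ty n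
  | all {n : ℕ} (g : Ty (n + 1)) (Ξ : Env (n + 1)) : Ty n

/-- Sensitivity types `G ::= g_Ξ`. -/
structure GTy (n : ℕ) where
  ty : Ty n
  eff : Env n

/-- The arrow type `G₁ → G₂`. -/
def Ty.arrow {n : ℕ} (G₁ G₂ : GTy n) : Ty n := .arr G₁.ty G₁.eff G₂.ty G₂.eff

/-- Substitution of environments for distance variables in types. -/
noncomputable def Ty.subst {m n : ℕ} : Ty m → (Fin m → Env n) → Ty n
  | .base b, _ => .base b
  | .arr g₁ Ξ₁ g₂ Ξ₂, σ => .arr (g₁.subst σ) (Ξ₁.subst σ) (g₂.subst σ) (Ξ₂.subst σ)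
  | .all g Ξ, σ => .all (g.subst (DSub.lift σ)) (Ξ.subst (DSub.lift σ))

noncomputable def GTy.subst {m n : ℕ} (G : GTy m) (σ : Fin m → Env n) : GTy n :=
  ⟨G.ty.subst σ, G.eff.subst σ⟩

/-- `dom ((G₁ → G₂)_Ξ) = G₁`. -/
def GTy.dom {n : ℕ} : GTy n → Option (GTy n)
  | ⟨.arr g₁ Ξ₁ _ _, _⟩ => some ⟨g₁, Ξ₁⟩
  | _ => none

/-- `cod ((G₁ → g₂_Ξ₂)_Ξ) = g₂_(Ξ₂ + Ξ)`. -/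
noncomputable def GTy.cod {n : ℕ} : GTy n → Option (GTy n)
  | ⟨.arr _ _ g₂ Ξ₂, Ξ⟩ => some ⟨g₂, Ξ₂ + Ξ⟩
  | _ => none

/-- `inst ((∀ r. G)_Ξ, Ξ') = G[Ξ'/r] + Ξ`. -/
noncomputable def GTy.inst {n : ℕ} (Ξ' : Env n) : GTy n → Option (GTy n)
  | ⟨.all g Ξ₀, Ξ⟩ =>
      some ⟨g.subst (DSub.inst Ξ'), Ξ₀.subst (DSub.inst Ξ') + Ξ⟩
  | _ => none

/-! ## Evidence -/

/-- Evidence for a consistent subtyping judgment: a pair of sensitivity types. -/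
structure Evd (n : ℕ) where
  fst : GTy n
  snd : GTy n

/-- The interior of `[s₁, s₂] ≲ [s₃, s₄]`. -/
noncomputable def Sens.interior (a b : Sens) : Option (Sens × Sens) :=
  open Classical in
  if h : a.fst ≤ a.snd ⊓ b.snd ∧ a.fst ⊔ b.fst ≤ b.snd then
    some (⟨(a.fst, a.snd ⊓ b.snd), h.1⟩, ⟨(a.fst ⊔ b.fst, b.snd), h.2⟩)
  else none

/-- Consistent transitivity of `⟨a₁, a₂⟩` and `⟨b₁, b₂⟩`. -/
noncomputable def Sens.trans (a₁ a₂ b₁ b₂ : Sens) : Option (Sens × Sens) :=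
  open Classical in
  if h : a₁.fst ≤ a₁.snd ⊓ a₂.snd ⊓ b₁.snd ∧ a₂.fst ⊔ b₁.fst ⊔ b₂.fst ≤ b₂.snd then
    some (⟨(a₁.fst, a₁.snd ⊓ a₂.snd ⊓ b₁.snd), h.1⟩,
      ⟨(a₂.fst ⊔ b₁.fst ⊔ b₂.fst, b₂.snd), h.2⟩)
  else none

noncomputable def Env.interior {n : ℕ} (Ξ₁ Ξ₂ : Env n) : Option (Env n × Env n) :=
  (optPi fun i => Sens.interior (Ξ₁ i) (Ξ₂ i)).map
    fun p => (fun i => (p i).1, fun i => (p i).2)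

noncomputable def Env.trans {n : ℕ} (Ξ₁ Ξ₂ Ξ₃ Ξ₄ : Env n) : Option (Env n × Env n) :=
  (optPi fun i => Sens.trans (Ξ₁ i) (Ξ₂ i) (Ξ₃ i) (Ξ₄ i)).map
    fun p => (fun i => (p i).1, fun i => (p i).2)

/-- The interior of a consistent subtyping judgment between types: the structural lifting of
the interior of sensitivities, contravariant in domains. Undefined if the judgment fails. -/
noncomputable def Ty.interior {n : ℕ} : Ty n → Ty n → Option (Ty n × Ty n)
  | .base b, .base b' => if b = b' then some (.base b, .base b') else none
  | .arr g₁ Ξ₁ g₂ Ξ₂, .arr g₁' Ξ₁' g₂' Ξ₂' => do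
      let d ← Ty.interior g₁' g₁
      let δ ← Env.interior Ξ₁' Ξ₁
      let c ← Ty.interior g₂ g₂'
      let γ ← Env.interior Ξ₂ Ξ₂'
      some (.arr d.2 δ.2 c.1 γ.1, .arr d.1 δ.1 c.2 γ.2)
  | .all g Ξ, .all g' Ξ' => do
      let c ← Ty.interior g g'
      let γ ← Env.interior Ξ Ξ'
      some (.all c.1 γ.1, .all c.2 γ.2)
  | _, _ => none
termination_by a b => sizeOf a + sizeOf b

/-- Consistent transitivity of `⟨t₁, t₂⟩` and `⟨t₃, t₄⟩`: the structural lifting of consistent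
transitivity of sensitivities, contravariant in domains. -/
noncomputable def Ty.trans {n : ℕ} : Ty n → Ty n → Ty n → Ty n → Option (Ty n × Ty n)
  | .base a, .base b, .base c, .base d =>
      if a = b ∧ b = c ∧ c = d then some (.base a, .base d) else none
  | .arr f₁ Φ₁ g₁ Ξ₁, .arr f₂ Φ₂ g₂ Ξ₂, .arr f₃ Φ₃ g₃ Ξ₃, .arr f₄ Φ₄ g₄ Ξ₄ => do
      let d ← Ty.trans f₄ f₃ f₂ f₁
      let δ ← Env.trans Φ₄ Φ₃ Φ₂ Φ₁
      let c ← Ty.trans g₁ g₂ g₃ g₄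
      let γ ← Env.trans Ξ₁ Ξ₂ Ξ₃ Ξ₄
      some (.arr d.2 δ.2 c.1 γ.1, .arr d.1 δ.1 c.2 γ.2)
  | .all g₁ Ξ₁, .all g₂ Ξ₂, .all g₃ Ξ₃, .all g₄ Ξ₄ => do
      let c ← Ty.trans g₁ g₂ g₃ g₄
      let γ ← Env.trans Ξ₁ Ξ₂ Ξ₃ Ξ₄
      some (.all c.1 γ.1, .all c.2 γ.2)
  | _, _, _, _ => none
termination_by a b c d => sizeOf a + sizeOf b + sizeOf c + sizeOf d

/-- The initial evidence of `G₁ ≲ G₂`. -/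
noncomputable def GTy.interior {n : ℕ} (G₁ G₂ : GTy n) : Option (Evd n) := do
  let t ← Ty.interior G₁.ty G₂.ty
  let e ← Env.interior G₁.eff G₂.eff
  some ⟨⟨t.1, e.1⟩, ⟨t.2, e.2⟩⟩

/-- Consistent transitivity of evidences. -/
noncomputable def Evd.trans {n : ℕ} (ε₁ ε₂ : Evd n) : Option (Evd n) := do
  let t ← Ty.trans ε₁.fst.ty ε₁.snd.ty ε₂.fst.ty ε₂.snd.ty
  let e ← Env.trans ε₁.fst.eff ε₁.snd.eff ε₂.fst.eff ε₂.snd.eff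
  some ⟨⟨t.1, e.1⟩, ⟨t.2, e.2⟩⟩

noncomputable def Evd.subst {m n : ℕ} (ε : Evd m) (σ : Fin m → Env n) : Evd n :=
  ⟨ε.fst.subst σ, ε.snd.subst σ⟩

def Evd.dom {n : ℕ} (ε : Evd n) : Option (Evd n) := do
  let a ← ε.snd.dom
  let b ← ε.fst.dom
  some ⟨a, b⟩

noncomputable def Evd.cod {n : ℕ} (ε : Evd n) : Option (Evd n) := do
  let a ← ε.fst.cod
  let b ← ε.snd.cod
  some ⟨a, b⟩

noncomputable def Evd.inst {n : ℕ} (Ξ : Env n) (ε : Evd n) : Option (Evd n) := do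
  let a ← ε.fst.inst Ξ
  let b ← ε.snd.inst Ξ
  some ⟨a, b⟩

/-! ## Constants and primitive operations -/

/-- The constants of a base type; `D` is the type of data. -/
abbrev Base.Carrier (D : Type) : Base → Type
  | .real => ℝ
  | .bool => Bool
  | .data => D

/-- The distance on a base type: `|x - y|` on the reals, the discrete distance on booleans, the
given distance on data. -/
noncomputable def Base.dist {D : Type} [PseudoEMetricSpace D] :
    (b : Base) → b.Carrier D → b.Carrier D → ENNReal
  | .real, x, y => edist (x : ℝ) y
  | .bool, x, y => if (x : Bool) = y then 0 else 1
  | .data, x, y => edist (x : D) y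

/-- A primitive `k`-ary operation: a total function on constants with the sensitivities
`s₁, …, sₖ` that its typing `δ_op(B₁_Ξ₁, …, Bₖ_Ξₖ) = B_(s₁ Ξ₁ + ⋯ + sₖ Ξₖ)` declares, which must
be true of the function. -/
structure Op (D : Type) [PseudoEMetricSpace D] where
  arity : ℕ
  dom : Fin arity → Base
  cod : Base
  fn : ((j : Fin arity) → (dom j).Carrier D) → cod.Carrier D
  sens : Fin arity → ENNReal
  sound : ∀ x y, cod.dist (fn x) (fn y) ≤ ∑ j, sens j * (dom j).dist (x j) (y j)

/-- `δ_op` (used when the `j`-th argument has base type `op.dom j`). -/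
noncomputable def Op.effect {D : Type} [PseudoEMetricSpace D] (op : Op D) {n : ℕ}
    (G : Fin op.arity → GTy n) : GTy n :=
  ⟨.base op.cod, fun i => ∑ j, NonemptyInterval.pure (op.sens j) * (G j).eff i⟩

/-- Addition, `δ_+(ℝ_Ξ₁, ℝ_Ξ₂) = ℝ_(Ξ₁ + Ξ₂)`. -/
noncomputable def Op.add (D : Type) [PseudoEMetricSpace D] : Op D where
  arity := 2
  dom := fun _ => .real
  cod := .real
  fn := fun x => ((x 0 : ℝ) + (x 1 : ℝ) : ℝ)
  sens := fun _ => 1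
  sound := by
    intro x y
    simp only [Fin.sum_univ_two, one_mul]
    exact edist_add_add_le (x 0 : ℝ) (x 1 : ℝ) (y 0 : ℝ) (y 1 : ℝ)

/-- Multiplication, `δ_*(ℝ_Ξ₁, ℝ_Ξ₂) = ℝ_(∞ (Ξ₁ + Ξ₂))`. -/
noncomputable def Op.mul (D : Type) [PseudoEMetricSpace D] : Op D where
  arity := 2
  dom := fun _ => .real
  cod := .real
  fn := fun x => ((x 0 : ℝ) * (x 1 : ℝ) : ℝ)
  sens := fun _ => ⊤
  sound := by
    intro x y
    simp only [Fin.sum_univ_two, Base.dist]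
    by_cases h0 : (x 0 : ℝ) = y 0
    · by_cases h1 : (x 1 : ℝ) = y 1
      · rw [h0, h1, edist_self]
        exact bot_le
      · rw [ENNReal.top_mul (fun h => h1 (edist_eq_zero.mp h))]
        simp
    · rw [ENNReal.top_mul (fun h => h0 (edist_eq_zero.mp h))]
      simp

/-- Comparison, `δ_≤(ℝ_Ξ₁, ℝ_Ξ₂) = 𝔹_(∞ (Ξ₁ + Ξ₂))`. -/
noncomputable def Op.leq (D : Type) [PseudoEMetricSpace D] : Op D where
  arity := 2
  dom := fun _ => .real
  cod := .bool
  fn := fun x => (open Classical in decide ((x 0 : ℝ) ≤ (x 1 : ℝ)) : Bool)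
  sens := fun _ => ⊤
  sound := by
    intro x y
    simp only [Fin.sum_univ_two, Base.dist]
    by_cases h0 : (x 0 : ℝ) = y 0
    · by_cases h1 : (x 1 : ℝ) = y 1
      · rw [h0, h1]
        simp
      · rw [ENNReal.top_mul (a := edist (x 1 : ℝ) (y 1)) (fun h => h1 (edist_eq_zero.mp h))]
        simp
    · rw [ENNReal.top_mul (a := edist (x 0 : ℝ) (y 0)) (fun h => h0 (edist_eq_zero.mp h))]
      simp

/-! ## Source expressions -/

/-- Expressions of the gradual language with `n` distance variables in scope. Term variables are
de Bruijn indices. -/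
inductive Src (D : Type) [PseudoEMetricSpace D] : ℕ → Type
  | const {n : ℕ} (b : Base) (c : b.Carrier D) : Src D n
  | op {n : ℕ} (o : Op D) (args : Fin o.arity → Src D n) : Src D n
  | var {n : ℕ} (x : ℕ) : Src D n
  | lam {n : ℕ} (G : GTy n) (e : Src D n) : Src D n
  | app {n : ℕ} (e₁ e₂ : Src D n) : Src D n
  | dlam {n : ℕ} (e : Src D (n + 1)) : Src D n
  | inst {n : ℕ} (e : Src D n) (Ξ : Env n) : Src D n
  | ascr {n : ℕ} (e : Src D n) (G : GTy n) : Src D n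

/-! ## The internal language with evidence -/

/-- Internal expressions. Simple values `u` (`const`, `lam`, `dlam v`) and distance abstractions
occur in programs only directly below an evidence ascription `asc ε u G`. -/
inductive Tm (D : Type) [PseudoEMetricSpace D] : ℕ → Type
  | const {n : ℕ} (b : Base) (c : b.Carrier D) : Tm D n
  | lam {n : ℕ} (G : GTy n) (e : Tm D n) : Tm D n
  | dlam {n : ℕ} (e : Tm D (n + 1)) : Tm D n
  | op {n : ℕ} (o : Op D) (args : Fin o.arity → Tm D n) : Tm D n
  | var {n : ℕ} (x : ℕ) : Tm D n
  | app {n : ℕ} (e₁ e₂ : Tm D n) : Tm D n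
  | inst {n : ℕ} (e : Tm D n) (Ξ : Env n) : Tm D n
  | asc {n : ℕ} (ε : Evd n) (e : Tm D n) (G : GTy n) : Tm D n

section Internal

variable {D : Type} [PseudoEMetricSpace D]

/-- Substitution of environments for distance variables in expressions. -/
noncomputable def Tm.dsubst {m n : ℕ} : Tm D m → (Fin m → Env n) → Tm D n
  | .const b c, _ => .const b c
  | .lam G e, σ => .lam (G.subst σ) (e.dsubst σ)
  | .dlam e, σ => .dlam (e.dsubst (DSub.lift σ))
  | .op o args, σ => .op o fun j => (args j).dsubst σ
  | .var x, _ => .var x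
  | .app e₁ e₂, σ => .app (e₁.dsubst σ) (e₂.dsubst σ)
  | .inst e Ξ, σ => .inst (e.dsubst σ) (Ξ.subst σ)
  | .asc ε e G, σ => .asc (ε.subst σ) (e.dsubst σ) (G.subst σ)

/-- `e.subst k v` replaces term variable `k` of `e` by the expression `v`, which must not have free
term variables. -/
noncomputable def Tm.subst {n : ℕ} : Tm D n → ℕ → Tm D n → Tm D n
  | .const b c, _, _ => .const b c
  | .lam G e, k, v => .lam G (e.subst (k + 1) v)
  | .dlam e, k, v => .dlam (e.subst k (v.dsubst (DSub.shift n)))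
  | .op o args, k, v => .op o fun j => (args j).subst k v
  | .var x, k, v => if x = k then v else if k < x then .var (x - 1) else .var x
  | .app e₁ e₂, k, v => .app (e₁.subst k v) (e₂.subst k v)
  | .inst e Ξ, k, v => .inst (e.subst k v) Ξ
  | .asc ε e G, k, v => .asc ε (e.subst k v) G

/-- Simple values `u ::= c | λ x : G. e | Λ r. v`, where `v ::= ε u :: G`. -/
inductive Tm.IsSimple : {n : ℕ} → Tm D n → Prop
  | const {n : ℕ} (b : Base) (c : b.Carrier D) : Tm.IsSimple (n := n) (.const b c)
  | lam {n : ℕ} (G : GTy n) (e : Tm D n) : Tm.IsSimple (.lam G e)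
  | dlam {n : ℕ} (ε : Evd (n + 1)) (u : Tm D (n + 1)) (G : GTy (n + 1)) :
      Tm.IsSimple u → Tm.IsSimple (.dlam (.asc ε u G))

/-- Values `v ::= ε u :: G`. -/
def Tm.IsVal {n : ℕ} (e : Tm D n) : Prop := ∃ ε u G, e = .asc ε u G ∧ u.IsSimple

/-- One step of call-by-value reduction, to an expression (`some e`) or to an error (`none`).
The last six rules are reduction inside, and propagation of errors through, the evaluation contexts
`op (v̅, E, e̅) | E e | v E | E[Ξ] | ε (Λ r. E) :: G | ε E :: G`. -/
inductive Step : {n : ℕ} → Tm D n → Option (Tm D n) → Prop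
  | op {n : ℕ} (o : Op D) (ε : Fin o.arity → Evd n)
      (c : (j : Fin o.arity) → (o.dom j).Carrier D) (G : Fin o.arity → GTy n) :
      Step (.op o fun j => .asc (ε j) (.const (o.dom j) (c j)) (G j))
        (some (.asc ⟨o.effect fun j => (ε j).fst, o.effect fun j => (ε j).snd⟩
          (.const o.cod (o.fn c)) (o.effect G)))
  | app {n : ℕ} {ε ε₁ εd εc ε' : Evd n} {A G G₁ C : GTy n} {e u : Tm D n} :
      u.IsSimple → ε.dom = some εd → ε.cod = some εc → G.cod = some C →
      ε₁.trans εd = some ε' →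
      Step (.app (.asc ε (.lam A e) G) (.asc ε₁ u G₁))
        (some (.asc εc (e.subst 0 (.asc ε' u A)) C))
  | app_error {n : ℕ} {ε ε₁ εd : Evd n} {A G G₁ : GTy n} {e u : Tm D n} :
      u.IsSimple → ε.dom = some εd → ε₁.trans εd = none →
      Step (.app (.asc ε (.lam A e) G) (.asc ε₁ u G₁)) none
  | inst {n : ℕ} {ε εi : Evd n} {G C : GTy n} {v : Tm D (n + 1)} {Ξ : Env n} :
      v.IsVal → ε.inst Ξ = some εi → G.inst Ξ = some C →
      Step (.inst (.asc ε (.dlam v) G) Ξ)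
        (some (.asc εi (v.dsubst (DSub.inst Ξ)) C))
  | ascr {n : ℕ} {ε ε' ε'' : Evd n} {G G' : GTy n} {u : Tm D n} :
      u.IsSimple → ε'.trans ε = some ε'' →
      Step (.asc ε (.asc ε' u G') G) (some (.asc ε'' u G))
  | ascr_error {n : ℕ} {ε ε' : Evd n} {G G' : GTy n} {u : Tm D n} :
      u.IsSimple → ε'.trans ε = none →
      Step (.asc ε (.asc ε' u G') G) none
  | op_arg {n : ℕ} (o : Op D) (args : Fin o.arity → Tm D n) (i : Fin o.arity)
      {r : Option (Tm D n)} :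
      (∀ j < i, (args j).IsVal) → Step (args i) r →
      Step (.op o args) (r.map fun e => .op o (Function.update args i e))
  | app_fun {n : ℕ} {e₁ e₂ : Tm D n} {r : Option (Tm D n)} :
      Step e₁ r → Step (.app e₁ e₂) (r.map fun e => .app e e₂)
  | app_arg {n : ℕ} {v e₂ : Tm D n} {r : Option (Tm D n)} :
      v.IsVal → Step e₂ r → Step (.app v e₂) (r.map fun e => .app v e)
  | inst_arg {n : ℕ} {e : Tm D n} {Ξ : Env n} {r : Option (Tm D n)} :
      Step e r → Step (.inst e Ξ) (r.map fun e' => .inst e' Ξ)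
  | dlam_body {n : ℕ} {ε : Evd n} {G : GTy n} {e : Tm D (n + 1)} {r : Option (Tm D (n + 1))} :
      Step e r → Step (.asc ε (.dlam e) G) (r.map fun e' => .asc ε (.dlam e') G)
  | asc_body {n : ℕ} {ε : Evd n} {G : GTy n} {e : Tm D n} {r : Option (Tm D n)} :
      Step e r → Step (.asc ε e G) (r.map fun e' => .asc ε e' G)

/-- Evaluation: `e` reduces in finitely many steps to the value `v` (`some v`) or to an error
(`none`). -/
def Evals {n : ℕ} (e : Tm D n) : Option (Tm D n) → Prop
  | some v => Relation.ReflTransGen (fun a b => Step a (some b)) e v ∧ v.IsVal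
  | none => ∃ e', Relation.ReflTransGen (fun a b => Step a (some b)) e e' ∧ Step e' none

/-! ## Type-directed translation -/

/-- `Translates Γ e e' G`: in the type environment `Γ`, the source expression `e` has type `G` and
elaborates to the internal expression `e'`. -/
inductive Translates : {n : ℕ} → List (GTy n) → Src D n → Tm D n → GTy n → Prop
  | const {n : ℕ} {Γ : List (GTy n)} (b : Base) (c : b.Carrier D) {ε : Evd n} :
      GTy.interior ⟨.base b, 0⟩ ⟨.base b, 0⟩ = some ε →
      Translates Γ (.const b c) (.asc ε (.const b c) ⟨.base b, 0⟩) ⟨.base b, 0⟩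
  | op {n : ℕ} {Γ : List (GTy n)} (o : Op D) {e : Fin o.arity → Src D n}
      {e' : Fin o.arity → Tm D n} {G : Fin o.arity → GTy n} :
      (∀ j, Translates Γ (e j) (e' j) (G j)) → (∀ j, (G j).ty = .base (o.dom j)) →
      Translates Γ (.op o e) (.op o e') (o.effect G)
  | var {n : ℕ} {Γ : List (GTy n)} {x : ℕ} {G : GTy n} :
      Γ[x]? = some G → Translates Γ (.var x) (.var x) G
  | lam {n : ℕ} {Γ : List (GTy n)} {G₁ G₂ : GTy n} {e : Src D n} {e' : Tm D n} {ε : Evd n} :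
      Translates (G₁ :: Γ) e e' G₂ →
      GTy.interior ⟨.arrow G₁ G₂, 0⟩ ⟨.arrow G₁ G₂, 0⟩ = some ε →
      Translates Γ (.lam G₁ e) (.asc ε (.lam G₁ e') ⟨.arrow G₁ G₂, 0⟩) ⟨.arrow G₁ G₂, 0⟩
  | app {n : ℕ} {Γ : List (GTy n)} {G₁ G₂ A C : GTy n} {e₁ e₂ : Src D n} {e₁' e₂' : Tm D n}
      {ε : Evd n} :
      Translates Γ e₁ e₁' G₁ → Translates Γ e₂ e₂' G₂ →
      G₁.dom = some A → G₁.cod = some C → GTy.interior G₂ A = some ε →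
      Translates Γ (.app e₁ e₂) (.app e₁' (.asc ε e₂' A)) C
  | dlam {n : ℕ} {Γ : List (GTy n)} {G : GTy (n + 1)} {e : Src D (n + 1)} {e' : Tm D (n + 1)}
      {ε : Evd n} :
      Translates (Γ.map fun H => H.subst (DSub.shift n)) e e' G →
      GTy.interior ⟨.all G.ty G.eff, 0⟩ ⟨.all G.ty G.eff, 0⟩ = some ε →
      Translates Γ (.dlam e) (.asc ε (.dlam e') ⟨.all G.ty G.eff, 0⟩) ⟨.all G.ty G.eff, 0⟩
  | inst {n : ℕ} {Γ : List (GTy n)} {G C : GTy n} {e : Src D n} {e' : Tm D n} {Ξ : Env n} :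
      Translates Γ e e' G → G.inst Ξ = some C →
      Translates Γ (.inst e Ξ) (.inst e' Ξ) C
  | ascr {n : ℕ} {Γ : List (GTy n)} {G G' : GTy n} {e : Src D n} {e' : Tm D n} {ε : Evd n} :
      Translates Γ e e' G → GTy.interior G G' = some ε →
      Translates Γ (.ascr e G') (.asc ε e' G') G'

/-! ## Queries and the deterministic part of the mechanism -/

/-- The type `T[1 r]` of the input. -/
def inputTy {n : ℕ} (T : Base) (r : Fin n) : GTy n := ⟨.base T, Env.single r 1⟩

/-- The type `Number[1 r]`. -/
def num1 {n : ℕ} (r : Fin n) : GTy n := ⟨.base .real, Env.single r 1⟩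

/-- The type `T[1 r] → Number[? r]` of queries of unknown sensitivity. -/
def queryTy {n : ℕ} (T : Base) (r : Fin n) : GTy n :=
  ⟨.arrow (inputTy T r) ⟨.base .real, Env.single r Sens.unknown⟩, 0⟩

/-- `f` is a value of type `T[1 r] → Number[? r]`: the value of some closed well-typed expression of
that type. -/
def IsQuery {n : ℕ} (T : Base) (r : Fin n) (f : Tm D n) : Prop :=
  ∃ e e', Translates [] e e' (queryTy T r) ∧ Evals e' (some f)

/-- The value of type `T[1 r]` holding the constant `c`. Its evidence `⟨T_∅, T_(1r)⟩`, the interior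
of `T_∅ ≲ T_(1r)`, is the only one that justifies this type for a constant. -/
def inputVal {n : ℕ} (T : Base) (r : Fin n) (c : T.Carrier D) : Tm D n :=
  .asc ⟨⟨.base T, 0⟩, inputTy T r⟩ (.const T c) (inputTy T r)

/-- The expression `f x :: Number[1 r]`, where `x` and `f` are variables `0` and `1`. -/
def checkedCall {n : ℕ} (r : Fin n) : Src D n := .ascr (.app (.var 1) (.var 0)) (num1 r)

/-- The evaluation of `f x :: Number[1 r]` in the environment `x : T[1 r]`,
`f : T[1 r] → Number[? r]`, with `x` bound to `c`: it yields a number (`some q`) or an error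
(`none`). -/
def CallEvals {n : ℕ} (T : Base) (r : Fin n) (f : Tm D n) (c : T.Carrier D) :
    Option ℝ → Prop
  | some q => ∃ e' ε G, Translates [inputTy T r, queryTy T r] (checkedCall r) e' (num1 r) ∧
      Evals ((e'.subst 0 (inputVal T r c)).subst 0 f)
        (some (.asc ε (.const .real (show Base.real.Carrier D from q)) G))
  | none => ∃ e', Translates [inputTy T r, queryTy T r] (checkedCall r) e' (num1 r) ∧
      Evals ((e'.subst 0 (inputVal T r c)).subst 0 f) none

end Internal

/-! ## The mechanisms -/

/-- The Laplace distribution with mean `μ` and scale `b`. -/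
noncomputable def laplaceMeasure (μ b : ℝ) : Measure ℝ :=
  volume.withDensity fun y => ENNReal.ofReal (1 / (2 * b) * Real.exp (-|y - μ| / b))

/-- `laplace(v, s, ε)`: the number `v` with Laplace noise for sensitivity `s` and privacy parameter
`ε`. -/
noncomputable def laplaceNoise (v s ε : ℝ) : Measure ℝ := laplaceMeasure v (s / ε)

section Mechanisms

variable {D : Type} [PseudoEMetricSpace D]

/-- The distribution of the outcome of `GLM(c, f, ε) = laplace(f(c) :: Number[1 x], 1, ε)`:
a noisy number (`Sum.inl`) or an error (`Sum.inr ()`). A call that would produce neither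
has no outcome. -/
noncomputable def glm {n : ℕ} (T : Base) (r : Fin n) (f : Tm D n) (ε : ℝ) (c : T.Carrier D) :
    Measure (ℝ ⊕ Unit) :=
  open Classical in
  if h : ∃ q, CallEvals T r f c (some q) then
    (laplaceNoise h.choose 1 ε).map Sum.inl
  else if CallEvals T r f c none then Measure.dirac (Sum.inr ())
  else 0

/-- The search for the first query, numbered from `i`, whose noisy result is at least the noisy
threshold `t`; a query whose GLM call fails is skipped, and `-1` is returned if none is found. -/
noncomputable def gatSearch {n : ℕ} (T : Base) (r : Fin n) (ε : ℝ) (c : T.Carrier D) (t : ℝ) :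
    ℤ → List (Tm D n) → Measure ℤ
  | _, [] => Measure.dirac (-1)
  | i, f :: fs => (glm T r f (ε / 4) c).bind fun o =>
      open Classical in
      match o with
      | .inl y => if t ≤ y then Measure.dirac i else gatSearch T r ε c t (i + 1) fs
      | .inr _ => gatSearch T r ε c t (i + 1) fs

/-- The distribution of the output of `GAT(c, fs, thr, ε)`. -/
noncomputable def gat {n : ℕ} (T : Base) (r : Fin n) (fs : List (Tm D n)) (thr ε : ℝ)
    (c : T.Carrier D) : Measure ℤ :=
  (laplaceNoise thr 1 (ε / 2)).bind fun t => gatSearch T r ε c t 0 fs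

/-- `M` is an `ε`-differentially private randomized algorithm on inputs of type `T`; inputs are
neighbours if their distance is at most `1`. -/
def DiffPrivate {Y : Type} [MeasurableSpace Y] (T : Base) (ε : ℝ)
    (M : T.Carrier D → Measure Y) : Prop :=
  (∀ c, IsProbabilityMeasure (M c)) ∧
  ∀ c c', T.dist c c' ≤ 1 → ∀ S, MeasurableSet S →
    M c S ≤ ENNReal.ofReal (Real.exp ε) * M c' S

end Mechanisms

/-! ## Arithmetic of sensitivities and environments -/

/-! The language cannot branch on the value of a constant, and whether a composition of evidence is
defined depends on types alone. Running a query on two inputs therefore gives the same reduction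
sequence, with the same evidence and the same failures; only constants differ. This is made precise
by `ConstRel Δ`: two expressions agree up to ascribed constants, and each pair of constants is at
distance at most the lower end of the right effect of its evidence, evaluated at the distances `Δ`.

`Step.simulation` shows that related expressions step in lockstep. Operations preserve the bound by
their declared sensitivities. Consistent transitivity preserves it because the lower end of the
right effect can only grow (`Evd.trans_eff`). Under `Λ` the relation is required for every distance
of the bound variable, and instantiation by `Ξ` selects the distance `Ξ.lower Δ`. The upper end of
the right effect is inherited from the outermost ascription (`Steps.asc_upper`). For `f(x) :: ℝ[1
r]` it is `1` at `r`, so a call that succeeds leaves a lower end of at most `1`, and the results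
differ by at most the distance of the inputs.

It remains to see that every call ends, in exactly one way. Determinism gives uniqueness. Existence
is a logical relation argument (`Translates.red`) by recursion on shapes: composition changes
sensitivities but never the underlying simple type, and an error is an admissible result. Together,
`IsQuery.glm_cases`: a query fails on all inputs, or it defines a 1-Lipschitz function of the input.

Privacy is then classical. Moving the mean of a Laplace distribution of scale `b` by `d` costs a
factor `exp (d / b)`. For Above Threshold, the threshold `t` on one input is compared with `t + 1`
on the other, at cost `exp (ε / 2)`. Queries that stay below the threshold then cost nothing, the
single one that answers costs another `exp (ε / 2)`, and failing queries are skipped on both inputs.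
-/

theorem Sens.ext_ends {a b : Sens} (h₁ : a.fst = b.fst) (h₂ : a.snd = b.snd) : a = b :=
  NonemptyInterval.ext (Prod.ext h₁ h₂)

theorem Sens.fst_sum {ι : Type*} (s : Finset ι) (f : ι → Sens) :
    (∑ j ∈ s, f j).fst = ∑ j ∈ s, (f j).fst := by
  classical
  induction s using Finset.induction_on with
  | empty => rfl
  | insert a s ha ih =>
    rw [Finset.sum_insert ha, Finset.sum_insert ha, NonemptyInterval.fst_add, ih]

theorem Sens.snd_sum {ι : Type*} (s : Finset ι) (f : ι → Sens) :
    (∑ j ∈ s, f j).snd = ∑ j ∈ s, (f j).snd := by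
  classical
  induction s using Finset.induction_on with
  | empty => rfl
  | insert a s ha ih =>
    rw [Finset.sum_insert ha, Finset.sum_insert ha, NonemptyInterval.snd_add, ih]

theorem Sens.fst_mul (a b : Sens) : (a * b).fst = a.fst * b.fst := rfl

theorem Env.single_fst {n : ℕ} (r i : Fin n) (s : Sens) :
    (Env.single r s i).fst = if i = r then s.fst else 0 := by
  unfold Env.single
  by_cases h : i = r
  · subst h; simp
  · simp [h]

theorem Env.single_snd {n : ℕ} (r i : Fin n) (s : Sens) :
    (Env.single r s i).snd = if i = r then s.snd else 0 := by
  unfold Env.single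
  by_cases h : i = r
  · subst h; simp
  · simp [h]

theorem Env.subst_fst {m n : ℕ} (Ξ : Env m) (σ : Fin m → Env n) (i : Fin n) :
    (Ξ.subst σ i).fst = ∑ j, (Ξ j).fst * (σ j i).fst := by
  simp [Env.subst, Sens.fst_sum]

theorem Env.subst_snd {m n : ℕ} (Ξ : Env m) (σ : Fin m → Env n) (i : Fin n) :
    (Ξ.subst σ i).snd = ∑ j, (Ξ j).snd * (σ j i).snd := by
  simp [Env.subst, Sens.snd_sum]

/-- Composition of distance substitutions. -/
noncomputable def DSub.comp {l m n : ℕ} (σ : Fin l → Env m) (τ : Fin m → Env n) :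
    Fin l → Env n := fun j => (σ j).subst τ

/-- The identity distance substitution. -/
def DSub.id (n : ℕ) : Fin n → Env n := fun j => Env.single j 1

/-- Sums and products are endpointwise, so this is associativity of matrix multiplication over `[0,
∞]`, once for each end. -/
theorem Env.subst_comp {l m n : ℕ} (Ξ : Env l) (σ : Fin l → Env m) (τ : Fin m → Env n) :
    (Ξ.subst σ).subst τ = Ξ.subst (DSub.comp σ τ) := by
  funext i
  refine Sens.ext_ends ?_ ?_
  · simp only [Env.subst_fst, DSub.comp, Finset.sum_mul, Finset.mul_sum]
    rw [Finset.sum_comm]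
    simp only [mul_assoc]
  · simp only [Env.subst_snd, DSub.comp, Finset.sum_mul, Finset.mul_sum]
    rw [Finset.sum_comm]
    simp only [mul_assoc]

theorem Env.subst_id {n : ℕ} (Ξ : Env n) : Ξ.subst (DSub.id n) = Ξ := by
  funext i
  refine Sens.ext_ends ?_ ?_
  · simp [Env.subst_fst, DSub.id, Env.single_fst]
  · simp [Env.subst_snd, DSub.id, Env.single_snd]

theorem Env.single_subst {m n : ℕ} (r : Fin m) (σ : Fin m → Env n) :
    (Env.single r 1).subst σ = σ r := by
  funext i
  refine Sens.ext_ends ?_ ?_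
  · simp [Env.subst_fst, Env.single_fst]
  · simp [Env.subst_snd, Env.single_snd]

/-- The one commutation needed to carry distance substitutions past a binder, in types and for
values placed under `Λ`. -/
theorem DSub.shift_comp_lift {m n : ℕ} (σ : Fin m → Env n) :
    DSub.comp (DSub.shift m) (DSub.lift σ) = DSub.comp σ (DSub.shift n) := by
  funext j
  simp [DSub.comp, DSub.shift, Env.single_subst, DSub.lift]

theorem DSub.lift_comp {l m n : ℕ} (σ : Fin l → Env m) (τ : Fin m → Env n) :
    DSub.comp (DSub.lift σ) (DSub.lift τ) = DSub.lift (DSub.comp σ τ) := by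
  funext j
  refine Fin.cases ?_ (fun j => ?_) j
  · simp [DSub.comp, DSub.lift, Env.single_subst]
  · change ((σ j).subst (DSub.shift m)).subst (DSub.lift τ) =
      ((σ j).subst τ).subst (DSub.shift n)
    rw [Env.subst_comp, DSub.shift_comp_lift, Env.subst_comp]

theorem DSub.lift_id (n : ℕ) : DSub.lift (DSub.id n) = DSub.id (n + 1) := by
  funext j
  refine Fin.cases ?_ (fun j => ?_) j
  · rfl
  · change (Env.single j 1).subst (DSub.shift n) = _
    rw [Env.single_subst]
    rfl

/-! ## Distance substitution in types, evidence and expressions -/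

theorem Ty.subst_comp {l : ℕ} (g : Ty l) : ∀ {m n : ℕ} (σ : Fin l → Env m) (τ : Fin m → Env n),
    (g.subst σ).subst τ = g.subst (DSub.comp σ τ) := by
  induction g with
  | base b => intros; rfl
  | arr g₁ Ξ₁ g₂ Ξ₂ ih₁ ih₂ => intros; simp [Ty.subst, ih₁, ih₂, Env.subst_comp]
  | all g Ξ ih => intros; simp [Ty.subst, ih, Env.subst_comp, DSub.lift_comp]

theorem Ty.subst_id {n : ℕ} (g : Ty n) : g.subst (DSub.id n) = g := by
  induction g with
  | base b => rfl
  | arr g₁ Ξ₁ g₂ Ξ₂ ih₁ ih₂ => simp [Ty.subst, ih₁, ih₂, Env.subst_id]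
  | all g Ξ ih => simp [Ty.subst, ih, Env.subst_id, DSub.lift_id]

theorem GTy.subst_comp {l m n : ℕ} (G : GTy l) (σ : Fin l → Env m) (τ : Fin m → Env n) :
    (G.subst σ).subst τ = G.subst (DSub.comp σ τ) := by
  simp [GTy.subst, Ty.subst_comp, Env.subst_comp]

theorem GTy.subst_id {n : ℕ} (G : GTy n) : G.subst (DSub.id n) = G := by
  simp [GTy.subst, Ty.subst_id, Env.subst_id]

theorem Evd.subst_comp {l m n : ℕ} (ε : Evd l) (σ : Fin l → Env m) (τ : Fin m → Env n) :
    (ε.subst σ).subst τ = ε.subst (DSub.comp σ τ) := by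
  simp [Evd.subst, GTy.subst_comp]

theorem Evd.subst_id {n : ℕ} (ε : Evd n) : ε.subst (DSub.id n) = ε := by
  simp [Evd.subst, GTy.subst_id]

section Terms

variable {D : Type} [PseudoEMetricSpace D]

theorem Tm.dsubst_comp {l : ℕ} (e : Tm D l) : ∀ {m n : ℕ} (σ : Fin l → Env m)
    (τ : Fin m → Env n), (e.dsubst σ).dsubst τ = e.dsubst (DSub.comp σ τ) := by
  induction e with
  | const b c => intros; rfl
  | lam G e ih => intros; simp [Tm.dsubst, ih, GTy.subst_comp]
  | dlam e ih => intros; simp [Tm.dsubst, ih, DSub.lift_comp]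
  | op o args ih => intros; simp [Tm.dsubst, ih]
  | var x => intros; rfl
  | app e₁ e₂ ih₁ ih₂ => intros; simp [Tm.dsubst, ih₁, ih₂]
  | inst e Ξ ih => intros; simp [Tm.dsubst, ih, Env.subst_comp]
  | asc ε e G ih => intros; simp [Tm.dsubst, ih, GTy.subst_comp, Evd.subst_comp]

theorem Tm.dsubst_id {n : ℕ} (e : Tm D n) : e.dsubst (DSub.id n) = e := by
  induction e with
  | const b c => rfl
  | lam G e ih => simp [Tm.dsubst, ih, GTy.subst_id]
  | dlam e ih => simp [Tm.dsubst, ih, DSub.lift_id]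
  | op o args ih => simp [Tm.dsubst, ih]
  | var x => rfl
  | app e₁ e₂ ih₁ ih₂ => simp [Tm.dsubst, ih₁, ih₂]
  | inst e Ξ ih => simp [Tm.dsubst, ih, Env.subst_id]
  | asc ε e G ih => simp [Tm.dsubst, ih, GTy.subst_id, Evd.subst_id]

theorem Tm.dsubst_shift_lift {m n : ℕ} (e : Tm D m) (σ : Fin m → Env n) :
    (e.dsubst (DSub.shift m)).dsubst (DSub.lift σ) = (e.dsubst σ).dsubst (DSub.shift n) := by
  rw [Tm.dsubst_comp, Tm.dsubst_comp, DSub.shift_comp_lift]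

/-! ## Simultaneous substitution of closed expressions for term variables -/

/-- All free term variables are smaller than `k`. -/
def Tm.Closed : {n : ℕ} → Tm D n → ℕ → Prop
  | _, .const _ _, _ => True
  | _, .lam _ e, k => e.Closed (k + 1)
  | _, .dlam e, k => e.Closed k
  | _, .op _ args, k => ∀ j, (args j).Closed k
  | _, .var x, k => x < k
  | _, .app e₁ e₂, k => e₁.Closed k ∧ e₂.Closed k
  | _, .inst e _, k => e.Closed k
  | _, .asc _ e _, k => e.Closed k

/-- Replaces each variable `k + x` by `γ x`, which must not have free term variables. -/
noncomputable def Tm.msubst {n : ℕ} : Tm D n → ℕ → (ℕ → Tm D n) → Tm D n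
  | .const b c, _, _ => .const b c
  | .lam G e, k, γ => .lam G (e.msubst (k + 1) γ)
  | .dlam e, k, γ => .dlam (e.msubst k fun x => (γ x).dsubst (DSub.shift n))
  | .op o args, k, γ => .op o fun j => (args j).msubst k γ
  | .var x, k, γ => if x < k then .var x else γ (x - k)
  | .app e₁ e₂, k, γ => .app (e₁.msubst k γ) (e₂.msubst k γ)
  | .inst e Ξ, k, γ => .inst (e.msubst k γ) Ξ
  | .asc ε e G, k, γ => .asc ε (e.msubst k γ) G

theorem Tm.Closed.mono {n : ℕ} {e : Tm D n} : ∀ {k l : ℕ}, e.Closed k → k ≤ l → e.Closed l := by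
  induction e with
  | const b c => intros; trivial
  | lam G e ih => intro k l h hkl; exact ih (k := k + 1) h (by omega)
  | dlam e ih => intro k l h hkl; exact ih (k := k) h hkl
  | op o args ih => intro k l h hkl j; exact ih j (h j) hkl
  | var x => intro k l h hkl; exact lt_of_lt_of_le h hkl
  | app e₁ e₂ ih₁ ih₂ => intro k l h hkl; exact ⟨ih₁ h.1 hkl, ih₂ h.2 hkl⟩
  | inst e Ξ ih => intro k l h hkl; exact ih (k := k) h hkl
  | asc ε e G ih => intro k l h hkl; exact ih (k := k) h hkl

theorem Tm.Closed.dsubst {m : ℕ} {e : Tm D m} :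
    ∀ {n k : ℕ} (σ : Fin m → Env n), e.Closed k → (e.dsubst σ).Closed k := by
  induction e with
  | const b c => intros; trivial
  | lam G e ih => intro n k σ h; exact ih (k := k + 1) σ h
  | dlam e ih => intro n k σ h; exact ih (k := k) _ h
  | op o args ih => intro n k σ h j; exact ih j σ (h j)
  | var x => intro n k σ h; exact h
  | app e₁ e₂ ih₁ ih₂ => intro n k σ h; exact ⟨ih₁ σ h.1, ih₂ σ h.2⟩
  | inst e Ξ ih => intro n k σ h; exact ih (k := k) σ h
  | asc ε e G ih => intro n k σ h; exact ih (k := k) σ h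

theorem Tm.Closed.subst_eq {n : ℕ} {e : Tm D n} :
    ∀ {k : ℕ} {v : Tm D n}, e.Closed k → e.subst k v = e := by
  induction e with
  | const b c => intros; rfl
  | lam G e ih => intro k v h; simp only [Tm.subst]; rw [ih (k := k + 1) h]
  | dlam e ih => intro k v h; simp only [Tm.subst]; rw [ih (k := k) h]
  | op o args ih => intro k v h; simp only [Tm.subst]; congr 1; funext j; exact ih j (h j)
  | var x =>
    intro k v h
    have h' : x < k := h
    simp only [Tm.subst]
    rw [if_neg h'.ne, if_neg (not_lt.mpr h'.le)]
  | app e₁ e₂ ih₁ ih₂ => intro k v h; simp only [Tm.subst]; rw [ih₁ h.1, ih₂ h.2]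
  | inst e Ξ ih => intro k v h; simp only [Tm.subst]; rw [ih (k := k) h]
  | asc ε e G ih => intro k v h; simp only [Tm.subst]; rw [ih (k := k) h]

theorem Tm.Closed.msubst_eq {n : ℕ} {e : Tm D n} :
    ∀ {k : ℕ} {γ : ℕ → Tm D n}, e.Closed k → e.msubst k γ = e := by
  induction e with
  | const b c => intros; rfl
  | lam G e ih => intro k v h; simp only [Tm.msubst]; rw [ih (k := k + 1) h]
  | dlam e ih => intro k v h; simp only [Tm.msubst]; rw [ih (k := k) h]
  | op o args ih => intro k v h; simp only [Tm.msubst]; congr 1; funext j; exact ih j (h j)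
  | var x =>
    intro k v h
    exact if_pos h
  | app e₁ e₂ ih₁ ih₂ => intro k v h; simp only [Tm.msubst]; rw [ih₁ h.1, ih₂ h.2]
  | inst e Ξ ih => intro k v h; simp only [Tm.msubst]; rw [ih (k := k) h]
  | asc ε e G ih => intro k v h; simp only [Tm.msubst]; rw [ih (k := k) h]

theorem Tm.closed_msubst {n : ℕ} (e : Tm D n) :
    ∀ (k : ℕ) (γ : ℕ → Tm D n), (∀ x, (γ x).Closed 0) → (e.msubst k γ).Closed k := by
  induction e with
  | const b c => intros; trivial
  | lam G e ih => intro k γ h; exact ih (k + 1) γ h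
  | dlam e ih => intro k γ h; exact ih k _ fun x => (h x).dsubst _
  | op o args ih => intro k γ h j; exact ih j k γ h
  | var x =>
    intro k γ h
    simp only [Tm.msubst]
    split_ifs with hx
    · exact hx
    · exact (h _).mono (Nat.zero_le k)
  | app e₁ e₂ ih₁ ih₂ => intro k γ h; exact ⟨ih₁ k γ h, ih₂ k γ h⟩
  | inst e Ξ ih => intro k γ h; exact ih k γ h
  | asc ε e G ih => intro k γ h; exact ih k γ h

theorem Tm.msubst_dsubst {m : ℕ} (e : Tm D m) :
    ∀ {n : ℕ} (k : ℕ) (γ : ℕ → Tm D m) (σ : Fin m → Env n),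
      (e.msubst k γ).dsubst σ = (e.dsubst σ).msubst k fun x => (γ x).dsubst σ := by
  induction e with
  | const b c => intros; rfl
  | lam G e ih => intro n k γ σ; simp [Tm.msubst, Tm.dsubst, ih]
  | dlam e ih => intro n k γ σ; simp [Tm.msubst, Tm.dsubst, ih, Tm.dsubst_shift_lift]
  | op o args ih => intro n k γ σ; simp [Tm.msubst, Tm.dsubst, ih]
  | var x =>
    intro n k γ σ
    simp only [Tm.msubst, Tm.dsubst]
    split_ifs <;> rfl
  | app e₁ e₂ ih₁ ih₂ => intro n k γ σ; simp [Tm.msubst, Tm.dsubst, ih₁, ih₂]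
  | inst e Ξ ih => intro n k γ σ; simp [Tm.msubst, Tm.dsubst, ih]
  | asc ε e G ih => intro n k γ σ; simp [Tm.msubst, Tm.dsubst, ih]

/-- Extends a sequence by a new first element. -/
def seqCons {α : Type} (v : α) (γ : ℕ → α) : ℕ → α
  | 0 => v
  | x + 1 => γ x

/-- β-reduction inserts the argument into a body already closed by `γ`. The inserted `γ x` are
closed, so the second substitution leaves them alone and the two merge into one environment. -/
theorem Tm.msubst_subst {n : ℕ} (e : Tm D n) :
    ∀ (k : ℕ) (γ : ℕ → Tm D n) (v : Tm D n), (∀ x, (γ x).Closed 0) →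
      (e.msubst (k + 1) γ).subst k v = e.msubst k (seqCons v γ) := by
  induction e with
  | const b c => intros; rfl
  | lam G e ih => intro k γ v h; simp [Tm.msubst, Tm.subst, ih _ _ _ h]
  | dlam e ih =>
    intro k γ v h
    simp only [Tm.msubst, Tm.subst]
    rw [ih _ _ _ fun x => (h x).dsubst _]
    congr 2
    funext x
    cases x <;> rfl
  | op o args ih => intro k γ v h; simp [Tm.msubst, Tm.subst, ih _ _ _ _ h]
  | var x =>
    intro k γ v h
    simp only [Tm.msubst]
    rcases lt_trichotomy x k with hx | hx | hx
    · rw [if_pos (by omega), if_pos hx]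
      simp only [Tm.subst]
      rw [if_neg hx.ne, if_neg (not_lt.mpr hx.le)]
    · subst hx
      simp [Tm.subst, seqCons]
    · rw [if_neg (by omega), if_neg (by omega), ((h _).mono (Nat.zero_le k)).subst_eq]
      obtain ⟨y, rfl⟩ : ∃ y, x = k + 1 + y := ⟨x - (k + 1), by omega⟩
      rw [show k + 1 + y - k = y + 1 by omega, show k + 1 + y - (k + 1) = y by omega]
      rfl
  | app e₁ e₂ ih₁ ih₂ => intro k γ v h; simp [Tm.msubst, Tm.subst, ih₁ _ _ _ h, ih₂ _ _ _ h]
  | inst e Ξ ih => intro k γ v h; simp [Tm.msubst, Tm.subst, ih _ _ _ h]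
  | asc ε e G ih => intro k γ v h; simp [Tm.msubst, Tm.subst, ih _ _ _ h]

end Terms

/-! ### Inversion and determinism of reduction -/

section Determinism

variable {D : Type} [PseudoEMetricSpace D]

theorem Step.op_inv {n : ℕ} {o : Op D} {args : Fin o.arity → Tm D n} {r : Option (Tm D n)}
    (h : Step (.op o args) r) :
    (∃ (ε : Fin o.arity → Evd n) (c : (j : Fin o.arity) → (o.dom j).Carrier D)
        (G : Fin o.arity → GTy n),
      (args = fun j => .asc (ε j) (.const (o.dom j) (c j)) (G j)) ∧
      r = some (.asc ⟨o.effect fun j => (ε j).fst, o.effect fun j => (ε j).snd⟩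
          (.const o.cod (o.fn c)) (o.effect G))) ∨
    ∃ (i : Fin o.arity) (r₀ : Option (Tm D n)), (∀ j < i, (args j).IsVal) ∧ Step (args i) r₀ ∧
      r = r₀.map fun e => .op o (Function.update args i e) := by
  -- The type of `args` depends on `o`, so the equation between the two operations is kept as a
  -- hypothesis and split by injectivity, the arguments being compared heterogeneously.
  generalize ht : Tm.op o args = t at h
  cases h with
  | op o' ε c G =>
    simp only [Tm.op.injEq] at ht
    obtain ⟨rfl, ht⟩ := ht
    exact .inl ⟨ε, c, G, eq_of_heq ht, rfl⟩
  | op_arg o' args' i hv hs =>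
    simp only [Tm.op.injEq] at ht
    obtain ⟨rfl, ht⟩ := ht
    obtain rfl := eq_of_heq ht
    exact .inr ⟨i, _, hv, hs, rfl⟩
  | _ => exact absurd ht (by simp)

theorem Step.app_inv {n : ℕ} {e₁ e₂ : Tm D n} {r : Option (Tm D n)} (h : Step (.app e₁ e₂) r) :
    (∃ ε A e G ε₁ u G₁ εd, e₁ = .asc ε (.lam A e) G ∧ e₂ = .asc ε₁ u G₁ ∧ u.IsSimple ∧
      ε.dom = some εd ∧
      ((∃ εc C ε', ε.cod = some εc ∧ G.cod = some C ∧ ε₁.trans εd = some ε' ∧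
        r = some (.asc εc (e.subst 0 (.asc ε' u A)) C)) ∨ (ε₁.trans εd = none ∧ r = none))) ∨
    (∃ r₀, Step e₁ r₀ ∧ r = r₀.map fun e => .app e e₂) ∨
    (∃ r₀, e₁.IsVal ∧ Step e₂ r₀ ∧ r = r₀.map fun e => .app e₁ e) := by
  cases h with
  | app hu hd hc hC ht =>
    exact .inl ⟨_, _, _, _, _, _, _, _, rfl, rfl, hu, hd, .inl ⟨_, _, _, hc, hC, ht, rfl⟩⟩
  | app_error hu hd ht =>
    exact .inl ⟨_, _, _, _, _, _, _, _, rfl, rfl, hu, hd, .inr ⟨ht, rfl⟩⟩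
  | app_fun h => exact .inr (.inl ⟨_, h, rfl⟩)
  | app_arg hv h => exact .inr (.inr ⟨_, hv, h, rfl⟩)

theorem Step.inst_inv {n : ℕ} {e : Tm D n} {Ξ : Env n} {r : Option (Tm D n)}
    (h : Step (.inst e Ξ) r) :
    (∃ ε v G εi C, e = .asc ε (.dlam v) G ∧ v.IsVal ∧ ε.inst Ξ = some εi ∧ G.inst Ξ = some C ∧
      r = some (.asc εi (v.dsubst (DSub.inst Ξ)) C)) ∨
    (∃ r₀, Step e r₀ ∧ r = r₀.map fun e' => .inst e' Ξ) := by
  cases h with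
  | inst hv hi hC => exact .inl ⟨_, _, _, _, _, rfl, hv, hi, hC, rfl⟩
  | inst_arg h => exact .inr ⟨_, h, rfl⟩

theorem Step.asc_inv {n : ℕ} {ε : Evd n} {e : Tm D n} {G : GTy n} {r : Option (Tm D n)}
    (h : Step (.asc ε e G) r) :
    (∃ ε' u G', e = .asc ε' u G' ∧ u.IsSimple ∧
      ((∃ ε'', ε'.trans ε = some ε'' ∧ r = some (.asc ε'' u G)) ∨
        (ε'.trans ε = none ∧ r = none))) ∨
    (∃ e₀ r₀, e = .dlam e₀ ∧ Step e₀ r₀ ∧ r = r₀.map fun e' => .asc ε (.dlam e') G) ∨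
    (∃ r₀, Step e r₀ ∧ r = r₀.map fun e' => .asc ε e' G) := by
  cases h with
  | ascr hu ht => exact .inl ⟨_, _, _, rfl, hu, .inl ⟨_, ht, rfl⟩⟩
  | ascr_error hu ht => exact .inl ⟨_, _, _, rfl, hu, .inr ⟨ht, rfl⟩⟩
  | dlam_body h => exact .inr (.inl ⟨_, _, rfl, h, rfl⟩)
  | asc_body h => exact .inr (.inr ⟨_, h, rfl⟩)

theorem Step.not_const {n : ℕ} {b : Base} {c : b.Carrier D} {r : Option (Tm D n)} :
    ¬ Step (.const b c) r := nofun

theorem Step.not_lam {n : ℕ} {G : GTy n} {e : Tm D n} {r : Option (Tm D n)} :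
    ¬ Step (.lam G e) r := nofun

theorem Step.not_dlam {n : ℕ} {e : Tm D (n + 1)} {r : Option (Tm D n)} :
    ¬ Step (.dlam e) r := nofun

/-- Induction is needed because reduction goes on below `Λ`: the body of a simple `Λ` must itself be
irreducible. -/
theorem Tm.IsSimple.not_step {n : ℕ} {u : Tm D n} (hu : u.IsSimple) :
    ∀ {ε : Evd n} {G : GTy n} {r : Option (Tm D n)}, ¬ Step (.asc ε u G) r := by
  induction hu with
  | const b c =>
    intro ε G r h
    rcases h.asc_inv with ⟨_, _, _, he, _⟩ | ⟨_, _, he, _⟩ | ⟨_, h, _⟩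
    · cases he
    · cases he
    · exact Step.not_const h
  | lam A e =>
    intro ε G r h
    rcases h.asc_inv with ⟨_, _, _, he, _⟩ | ⟨_, _, he, _⟩ | ⟨_, h, _⟩
    · cases he
    · cases he
    · exact Step.not_lam h
  | dlam ε' u G' hu ih =>
    intro ε G r h
    rcases h.asc_inv with ⟨_, _, _, he, _⟩ | ⟨_, _, he, h, _⟩ | ⟨_, h, _⟩
    · cases he
    · cases he
      exact ih h
    · exact Step.not_dlam h

theorem Tm.IsVal.not_step {n : ℕ} {v : Tm D n} (hv : v.IsVal) {r : Option (Tm D n)} :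
    ¬ Step v r := by
  obtain ⟨ε, u, G, rfl, hu⟩ := hv
  exact hu.not_step

/-- Rules overlap only if a value steps or a bare simple expression does; neither is possible. In
particular `dlam_body` and `asc_body` never compete, since a bare `Λ` does not step. -/
theorem Step.deterministic {n : ℕ} {e : Tm D n} {r : Option (Tm D n)} (h : Step e r) :
    ∀ {r' : Option (Tm D n)}, Step e r' → r = r' := by
  induction h with
  | op o ε c G =>
    intro r' h'
    rcases h'.op_inv with ⟨ε', c', G', ha, rfl⟩ | ⟨i, r₀, _, hs, _⟩
    · have hε : ε = ε' := funext fun j => by have := congrFun ha j; simp at this; exact this.1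
      have hc : c = c' := funext fun j => by have := congrFun ha j; simp at this; exact this.2.1
      have hG : G = G' := funext fun j => by have := congrFun ha j; simp at this; exact this.2.2
      subst hε hc hG
      rfl
    · exact absurd hs (Tm.IsSimple.const _ _).not_step
  | app hu hd hc hC ht =>
    intro r' h'
    rcases h'.app_inv with ⟨_, _, _, _, _, _, _, _, he₁, he₂, _, hd', h⟩ | ⟨_, h, _⟩ | ⟨_, _, h, _⟩
    · cases he₁
      cases he₂
      obtain rfl := Option.some.inj (hd.symm.trans hd')
      rcases h with ⟨_, _, _, hc', hC', ht', rfl⟩ | ⟨ht', _⟩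
      · obtain rfl := Option.some.inj (hc.symm.trans hc')
        obtain rfl := Option.some.inj (hC.symm.trans hC')
        obtain rfl := Option.some.inj (ht.symm.trans ht')
        rfl
      · rw [ht] at ht'
        cases ht'
    · exact absurd h (Tm.IsSimple.lam _ _).not_step
    · exact absurd h hu.not_step
  | app_error hu hd ht =>
    intro r' h'
    rcases h'.app_inv with ⟨_, _, _, _, _, _, _, _, he₁, he₂, _, hd', h⟩ | ⟨_, h, _⟩ | ⟨_, _, h, _⟩
    · cases he₁
      cases he₂
      obtain rfl := Option.some.inj (hd.symm.trans hd')
      rcases h with ⟨_, _, _, hc', hC', ht', rfl⟩ | ⟨_, rfl⟩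
      · rw [ht] at ht'
        cases ht'
      · rfl
    · exact absurd h (Tm.IsSimple.lam _ _).not_step
    · exact absurd h hu.not_step
  | inst hv hi hC =>
    intro r' h'
    rcases h'.inst_inv with ⟨_, _, _, _, _, he, _, hi', hC', rfl⟩ | ⟨_, h, _⟩
    · cases he
      obtain rfl := Option.some.inj (hi.symm.trans hi')
      obtain rfl := Option.some.inj (hC.symm.trans hC')
      rfl
    · obtain ⟨_, _, _, rfl, hu⟩ := hv
      exact absurd h (Tm.IsSimple.dlam _ _ _ hu).not_step
  | ascr hu ht =>
    intro r' h'
    rcases h'.asc_inv with ⟨_, _, _, he, _, h⟩ | ⟨_, _, he, _⟩ | ⟨_, h, _⟩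
    · cases he
      rcases h with ⟨_, ht', rfl⟩ | ⟨ht', _⟩
      · obtain rfl := Option.some.inj (ht.symm.trans ht')
        rfl
      · rw [ht] at ht'
        cases ht'
    · cases he
    · exact absurd h hu.not_step
  | ascr_error hu ht =>
    intro r' h'
    rcases h'.asc_inv with ⟨_, _, _, he, _, h⟩ | ⟨_, _, he, _⟩ | ⟨_, h, _⟩
    · cases he
      rcases h with ⟨_, ht', rfl⟩ | ⟨_, rfl⟩
      · rw [ht] at ht'
        cases ht'
      · rfl
    · cases he
    · exact absurd h hu.not_step
  | op_arg o args i hv hs ih =>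
    intro r' h'
    rcases h'.op_inv with ⟨ε', c', G', rfl, rfl⟩ | ⟨i', r₀, hv', hs', rfl⟩
    · exact absurd hs (Tm.IsSimple.const _ _).not_step
    · rcases lt_trichotomy i i' with hi | rfl | hi
      · exact absurd hs (hv' i hi).not_step
      · rw [ih hs']
      · exact absurd hs' (hv i' hi).not_step
  | app_fun hs ih =>
    intro r' h'
    rcases h'.app_inv with ⟨_, _, _, _, _, _, _, _, rfl, _⟩ | ⟨_, h, rfl⟩ | ⟨_, hv, h, _⟩
    · exact absurd hs (Tm.IsSimple.lam _ _).not_step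
    · rw [ih h]
    · exact absurd hs hv.not_step
  | app_arg hv hs ih =>
    intro r' h'
    rcases h'.app_inv with ⟨_, _, _, _, _, _, _, _, _, rfl, hu, _⟩ | ⟨_, h, rfl⟩ | ⟨_, _, h, rfl⟩
    · exact absurd hs hu.not_step
    · exact absurd h hv.not_step
    · rw [ih h]
  | inst_arg hs ih =>
    intro r' h'
    rcases h'.inst_inv with ⟨_, _, _, _, _, rfl, ⟨_, _, _, rfl, hu⟩, _⟩ | ⟨_, h, rfl⟩
    · exact absurd hs (Tm.IsSimple.dlam _ _ _ hu).not_step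
    · rw [ih h]
  | dlam_body hs ih =>
    intro r' h'
    rcases h'.asc_inv with ⟨_, _, _, he, _⟩ | ⟨_, _, he, h, rfl⟩ | ⟨_, h, _⟩
    · cases he
    · cases he
      rw [ih h]
    · exact absurd h Step.not_dlam
  | asc_body hs ih =>
    intro r' h'
    rcases h'.asc_inv with ⟨_, _, _, rfl, hu, _⟩ | ⟨_, _, rfl, _⟩ | ⟨_, h, rfl⟩
    · exact absurd hs hu.not_step
    · exact absurd hs Step.not_dlam
    · rw [ih h]

/-- Reduction in any number of steps. -/
abbrev Steps {n : ℕ} : Tm D n → Tm D n → Prop := Relation.ReflTransGen fun a b => Step a (some b)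

theorem Steps.total {n : ℕ} {e a b : Tm D n} (ha : Steps e a) (hb : Steps e b) :
    Steps a b ∨ Steps b a :=
  Relation.ReflTransGen.total_of_right_unique
    (fun _ _ _ h h' => Option.some.inj (h.deterministic h')) ha hb

theorem Steps.eq_of_isVal {n : ℕ} {v e : Tm D n} (h : Steps v e) (hv : v.IsVal) : e = v := by
  rcases h.cases_head with rfl | ⟨_, hs, _⟩
  · rfl
  · exact absurd hs hv.not_step

theorem Steps.eq_of_error {n : ℕ} {a e : Tm D n} (h : Steps a e) (ha : Step a none) : e = a := by
  rcases h.cases_head with rfl | ⟨_, hs, _⟩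
  · rfl
  · cases ha.deterministic hs

/-- By determinism two reduction sequences from `e` are comparable, and each ends where nothing
other than its own outcome can follow. -/
theorem Evals.unique {n : ℕ} {e : Tm D n} {r r' : Option (Tm D n)} (h : Evals e r)
    (h' : Evals e r') : r = r' := by
  rcases r with _ | v <;> rcases r' with _ | v'
  · rfl
  · obtain ⟨a, ha, hs⟩ := h
    obtain ⟨hv, hv'⟩ := h'
    rcases Steps.total ha hv with h | h
    · rw [h.eq_of_error hs] at hv'
      exact absurd hs hv'.not_step
    · rw [h.eq_of_isVal hv'] at hs
      exact absurd hs hv'.not_step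
  · obtain ⟨a, ha, hs⟩ := h'
    obtain ⟨hv, hv'⟩ := h
    rcases Steps.total ha hv with h | h
    · rw [h.eq_of_error hs] at hv'
      exact absurd hs hv'.not_step
    · rw [h.eq_of_isVal hv'] at hs
      exact absurd hs hv'.not_step
  · rcases Steps.total h.1 h'.1 with h'' | h''
    · rw [h''.eq_of_isVal h.2]
    · rw [h''.eq_of_isVal h'.2]

end Determinism

/-! ## Shapes: types without sensitivities -/

/-- Types without their sensitivities. -/
inductive Shape
  | base (b : Base)
  | arr (s t : Shape)
  | all (s : Shape)

def Ty.shape : {n : ℕ} → Ty n → Shape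
  | _, .base b => .base b
  | _, .arr g₁ _ g₂ _ => .arr g₁.shape g₂.shape
  | _, .all g _ => .all g.shape

theorem Ty.shape_subst {m : ℕ} (g : Ty m) :
    ∀ {n : ℕ} (σ : Fin m → Env n), (g.subst σ).shape = g.shape := by
  induction g with
  | base b => intros; rfl
  | arr g₁ Ξ₁ g₂ Ξ₂ ih₁ ih₂ => intros; simp [Ty.subst, Ty.shape, ih₁, ih₂]
  | all g Ξ ih => intros; simp [Ty.subst, Ty.shape, ih]

/-- Contravariance in domains exchanges the two arguments, so the induction needs `a` in either
position. -/
theorem Ty.interior_shape {n : ℕ} (a : Ty n) : ∀ (b : Ty n) (p : Ty n × Ty n),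
    (Ty.interior a b = some p →
      b.shape = a.shape ∧ p.1.shape = a.shape ∧ p.2.shape = a.shape) ∧
    (Ty.interior b a = some p →
      b.shape = a.shape ∧ p.1.shape = a.shape ∧ p.2.shape = a.shape) := by
  induction a with
  | base B =>
    intro b p
    cases b with
    | base B' =>
      simp only [Ty.interior]
      refine ⟨fun h => ?_, fun h => ?_⟩ <;> split_ifs at h with hB <;> cases h <;> subst hB <;>
        exact ⟨rfl, rfl, rfl⟩
    | _ => simp [Ty.interior]
  | arr g₁ Ξ₁ g₂ Ξ₂ ih₁ ih₂ =>
    intro b p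
    cases b with
    | arr g₁' Ξ₁' g₂' Ξ₂' =>
      simp only [Ty.interior, Option.bind_eq_bind, Option.bind_eq_some_iff, Option.some.injEq]
      refine ⟨?_, ?_⟩ <;> rintro ⟨d, hd, δ, -, c, hc, γ, -, rfl⟩
      · obtain ⟨h₁, h₂, h₃⟩ := (ih₁ _ _).2 hd
        obtain ⟨h₄, h₅, h₆⟩ := (ih₂ _ _).1 hc
        simp [Ty.shape, *]
      · obtain ⟨h₁, h₂, h₃⟩ := (ih₁ _ _).1 hd
        obtain ⟨h₄, h₅, h₆⟩ := (ih₂ _ _).2 hc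
        simp [Ty.shape, *]
    | _ => simp [Ty.interior]
  | all g Ξ ih =>
    intro b p
    cases b with
    | all g' Ξ' =>
      simp only [Ty.interior, Option.bind_eq_bind, Option.bind_eq_some_iff, Option.some.injEq]
      refine ⟨?_, ?_⟩ <;> rintro ⟨c, hc, γ, -, rfl⟩
      · obtain ⟨h₁, h₂, h₃⟩ := (ih _ _).1 hc
        simp [Ty.shape, *]
      · obtain ⟨h₁, h₂, h₃⟩ := (ih _ _).2 hc
        simp [Ty.shape, *]
    | _ => simp [Ty.interior]

/-- The composition in domains reverses the four types, hence the two statements with `a` first and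
`a` last. -/
theorem Ty.trans_shape {n : ℕ} (a : Ty n) : ∀ (b c d : Ty n) (p : Ty n × Ty n),
    (Ty.trans a b c d = some p → p.1.shape = a.shape ∧ p.2.shape = a.shape) ∧
    (Ty.trans d c b a = some p → p.1.shape = a.shape ∧ p.2.shape = a.shape) := by
  induction a with
  | base B =>
    intro b c d p
    cases b <;> cases c <;> cases d <;> simp only [Ty.trans, reduceCtorEq, false_imp_iff, and_self]
    refine ⟨fun h => ?_, fun h => ?_⟩ <;> split_ifs at h with hB <;> cases h <;>
      obtain ⟨rfl, rfl, rfl⟩ := hB <;> exact ⟨rfl, rfl⟩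
  | arr g₁ Ξ₁ g₂ Ξ₂ ih₁ ih₂ =>
    intro b c d p
    cases b <;> cases c <;> cases d <;> simp only [Ty.trans, reduceCtorEq, false_imp_iff, and_self]
    simp only [Option.bind_eq_bind, Option.bind_eq_some_iff, Option.some.injEq]
    refine ⟨?_, ?_⟩ <;> rintro ⟨d, hd, δ, -, c, hc, γ, -, rfl⟩
    · obtain ⟨h₁, h₂⟩ := (ih₁ _ _ _ _).2 hd
      obtain ⟨h₃, h₄⟩ := (ih₂ _ _ _ _).1 hc
      simp [Ty.shape, *]
    · obtain ⟨h₁, h₂⟩ := (ih₁ _ _ _ _).1 hd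
      obtain ⟨h₃, h₄⟩ := (ih₂ _ _ _ _).2 hc
      simp [Ty.shape, *]
  | all g Ξ ih =>
    intro b c d p
    cases b <;> cases c <;> cases d <;> simp only [Ty.trans, reduceCtorEq, false_imp_iff, and_self]
    simp only [Option.bind_eq_bind, Option.bind_eq_some_iff, Option.some.injEq]
    refine ⟨?_, ?_⟩ <;> rintro ⟨c, hc, γ, -, rfl⟩
    · obtain ⟨h₁, h₂⟩ := (ih _ _ _ _).1 hc
      simp [Ty.shape, *]
    · obtain ⟨h₁, h₂⟩ := (ih _ _ _ _).2 hc
      simp [Ty.shape, *]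

/-- Both types of the evidence have shape `s`. -/
def Evd.HasShape {n : ℕ} (ε : Evd n) (s : Shape) : Prop :=
  ε.fst.ty.shape = s ∧ ε.snd.ty.shape = s

theorem Evd.HasShape.subst {m n : ℕ} {ε : Evd m} {s : Shape} (h : ε.HasShape s)
    (σ : Fin m → Env n) : (ε.subst σ).HasShape s :=
  ⟨(Ty.shape_subst _ _).trans h.1, (Ty.shape_subst _ _).trans h.2⟩

theorem Evd.HasShape.trans {n : ℕ} {ε₁ ε₂ ε : Evd n} {s : Shape} (h : ε₁.HasShape s)
    (ht : ε₁.trans ε₂ = some ε) : ε.HasShape s := by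
  simp only [Evd.trans, Option.bind_eq_bind, Option.bind_eq_some_iff, Option.some.injEq] at ht
  obtain ⟨t, ht, e, -, rfl⟩ := ht
  obtain ⟨h₁, h₂⟩ := (Ty.trans_shape _ _ _ _ _).1 ht
  exact ⟨h₁.trans h.1, h₂.trans h.1⟩

theorem GTy.interior_shape {n : ℕ} {G G' : GTy n} {ε : Evd n} (h : G.interior G' = some ε) :
    G'.ty.shape = G.ty.shape ∧ ε.HasShape G.ty.shape := by
  simp only [GTy.interior, Option.bind_eq_bind, Option.bind_eq_some_iff, Option.some.injEq] at h
  obtain ⟨t, ht, e, -, rfl⟩ := h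
  obtain ⟨h₁, h₂, h₃⟩ := (Ty.interior_shape _ _ _).1 ht
  exact ⟨h₁, h₂, h₃⟩

theorem GTy.dom_of_shape {n : ℕ} {G : GTy n} {s t : Shape} (h : G.ty.shape = .arr s t) :
    ∃ A, G.dom = some A ∧ A.ty.shape = s := by
  obtain ⟨g, Ξ⟩ := G
  cases g with
  | arr g₁ Ξ₁ g₂ Ξ₂ => simp only [Ty.shape, Shape.arr.injEq] at h; exact ⟨_, rfl, h.1⟩
  | _ => simp [Ty.shape] at h

theorem GTy.cod_of_shape {n : ℕ} {G : GTy n} {s t : Shape} (h : G.ty.shape = .arr s t) :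
    ∃ C, G.cod = some C ∧ C.ty.shape = t := by
  obtain ⟨g, Ξ⟩ := G
  cases g with
  | arr g₁ Ξ₁ g₂ Ξ₂ => simp only [Ty.shape, Shape.arr.injEq] at h; exact ⟨_, rfl, h.2⟩
  | _ => simp [Ty.shape] at h

theorem GTy.inst_of_shape {n : ℕ} {G : GTy n} {s : Shape} (h : G.ty.shape = .all s) (Ξ : Env n) :
    ∃ C, G.inst Ξ = some C ∧ C.ty.shape = s := by
  obtain ⟨g, Ξ'⟩ := G
  cases g with
  | all g Ξ₁ =>
    simp only [Ty.shape, Shape.all.injEq] at h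
    exact ⟨_, rfl, (Ty.shape_subst _ _).trans h⟩
  | _ => simp [Ty.shape] at h

theorem Evd.HasShape.dom {n : ℕ} {ε : Evd n} {s t : Shape} (h : ε.HasShape (.arr s t)) :
    ∃ ε', ε.dom = some ε' ∧ ε'.HasShape s := by
  obtain ⟨A, hA, hs⟩ := GTy.dom_of_shape h.1
  obtain ⟨B, hB, hs'⟩ := GTy.dom_of_shape h.2
  exact ⟨⟨B, A⟩, by simp [Evd.dom, hA, hB], hs', hs⟩

theorem Evd.HasShape.cod {n : ℕ} {ε : Evd n} {s t : Shape} (h : ε.HasShape (.arr s t)) :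
    ∃ ε', ε.cod = some ε' ∧ ε'.HasShape t := by
  obtain ⟨A, hA, hs⟩ := GTy.cod_of_shape h.1
  obtain ⟨B, hB, hs'⟩ := GTy.cod_of_shape h.2
  exact ⟨⟨A, B⟩, by simp [Evd.cod, hA, hB], hs, hs'⟩

theorem Evd.HasShape.inst {n : ℕ} {ε : Evd n} {s : Shape} (h : ε.HasShape (.all s)) (Ξ : Env n) :
    ∃ ε', ε.inst Ξ = some ε' ∧ ε'.HasShape s := by
  obtain ⟨A, hA, hs⟩ := GTy.inst_of_shape h.1 Ξ
  obtain ⟨B, hB, hs'⟩ := GTy.inst_of_shape h.2 Ξ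
  exact ⟨⟨A, B⟩, by simp [Evd.inst, hA, hB], hs, hs'⟩

section Normalization

variable {D : Type} [PseudoEMetricSpace D]

/-! ## The logical relation for normalization -/

/-- `e` reduces to an error or to an expression satisfying `P`. -/
def Red {n : ℕ} (P : Tm D n → Prop) (e : Tm D n) : Prop :=
  (∃ v, Steps e v ∧ P v) ∨ Evals e none

/-- The values whose evidence and type have shape `s` and whose simple value satisfies `P`. -/
def ValOf {n : ℕ} (s : Shape) (P : Tm D n → Prop) (v : Tm D n) : Prop :=
  ∃ ε u G, v = .asc ε u G ∧ ε.HasShape s ∧ G.ty.shape = s ∧ P u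

/-- The simple values of shape `s` that evaluate hereditarily; functions are applied after
arbitrary distance substitutions. -/
def Good (D : Type) [PseudoEMetricSpace D] : Shape → {n : ℕ} → Tm D n → Prop
  | .base b, _, u => ∃ c, u = .const b c
  | .arr s t, n, u => ∃ A e, u = .lam A e ∧ A.ty.shape = s ∧ e.Closed 1 ∧
      ∀ (m : ℕ) (σ : Fin n → Env m) (v : Tm D m), ValOf s (Good D s) v →
        Red (ValOf t (Good D t)) ((e.dsubst σ).subst 0 v)
  | .all s, _, u => ∃ v, u = .dlam v ∧ ValOf s (Good D s) v

/-- The values of shape `s` that evaluate hereditarily. -/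
abbrev GoodVal (s : Shape) {n : ℕ} (v : Tm D n) : Prop := ValOf s (Good D s) v

theorem Good.isSimple {s : Shape} : ∀ {n : ℕ} {u : Tm D n}, Good D s u → u.IsSimple := by
  induction s with
  | base b => rintro n u ⟨c, rfl⟩; exact .const _ _
  | arr s t _ _ => rintro n u ⟨A, e, rfl, -⟩; exact .lam _ _
  | all s ih => rintro n u ⟨_, rfl, ε, w, G, rfl, -, -, h⟩; exact Tm.IsSimple.dlam ε w G (ih (u := w) h)

theorem Good.closed {s : Shape} : ∀ {n : ℕ} {u : Tm D n}, Good D s u → u.Closed 0 := by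
  induction s with
  | base b => rintro n u ⟨c, rfl⟩; trivial
  | arr s t _ _ => rintro n u ⟨A, e, rfl, -, h, -⟩; exact h
  | all s ih => rintro n u ⟨_, rfl, ε, w, G, rfl, -, -, h⟩; exact ih (u := w) h

/-- `Good` at arrow shapes quantifies over all distance substitutions precisely so that this closure
holds by composing them. -/
theorem Good.dsubst {s : Shape} : ∀ {m n : ℕ} {u : Tm D m} (σ : Fin m → Env n), Good D s u →
    Good D s (u.dsubst σ) := by
  induction s with
  | base b => rintro m n u σ ⟨c, rfl⟩; exact ⟨c, rfl⟩
  | arr s t _ _ =>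
    rintro m n u σ ⟨A, e, rfl, hA, hc, h⟩
    refine ⟨_, _, rfl, (Ty.shape_subst _ _).trans hA, hc.dsubst σ, fun l τ v hv => ?_⟩
    rw [Tm.dsubst_comp]
    exact h _ _ _ hv
  | all s ih =>
    rintro m n u σ ⟨_, rfl, ε, w, G, rfl, hε, hG, h⟩
    exact ⟨_, rfl, _, _, _, rfl, hε.subst _, (Ty.shape_subst _ _).trans hG, ih _ h⟩

theorem ValOf.isVal {s : Shape} {n : ℕ} {v : Tm D n} (h : GoodVal s v) : v.IsVal := by
  obtain ⟨ε, u, G, rfl, -, -, h⟩ := h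
  exact ⟨_, _, _, rfl, h.isSimple⟩

theorem ValOf.closed {s : Shape} {n : ℕ} {v : Tm D n} (h : GoodVal s v) : v.Closed 0 := by
  obtain ⟨ε, u, G, rfl, -, -, h⟩ := h
  exact h.closed

theorem ValOf.dsubst {s : Shape} {m n : ℕ} {v : Tm D m} (h : GoodVal s v) (σ : Fin m → Env n) :
    GoodVal s (v.dsubst σ) := by
  obtain ⟨ε, u, G, rfl, hε, hG, h⟩ := h
  exact ⟨_, _, _, rfl, hε.subst _, (Ty.shape_subst _ _).trans hG, h.dsubst σ⟩

theorem Red.steps {n : ℕ} {P : Tm D n → Prop} {e e' : Tm D n} (h : Steps e e') (h' : Red P e') :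
    Red P e := by
  rcases h' with ⟨v, hv, hP⟩ | ⟨a, ha, hs⟩
  · exact .inl ⟨v, h.trans hv, hP⟩
  · exact .inr ⟨a, h.trans ha, hs⟩

theorem Red.step {n : ℕ} {P : Tm D n → Prop} {e e' : Tm D n} (h : Step e (some e'))
    (h' : Red P e') : Red P e := h'.steps (.single h)

/-- Evaluation inside an evaluation context `E`. -/
theorem Red.bind {m n : ℕ} {P : Tm D m → Prop} {Q : Tm D n → Prop} (E : Tm D m → Tm D n)
    (hE : ∀ {e r}, Step e r → Step (E e) (r.map E)) {e : Tm D m} (h : Red P e)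
    (hPQ : ∀ v, P v → Red Q (E v)) : Red Q (E e) := by
  have lift : ∀ {a b}, Steps a b → Steps (E a) (E b) := fun h =>
    Relation.ReflTransGen.lift (p := fun a b => Step a (some b)) E (fun _ _ h => hE h) _ _ h
  rcases h with ⟨v, hv, hP⟩ | ⟨a, ha, hs⟩
  · exact (hPQ v hP).steps (lift hv)
  · exact .inr ⟨_, lift ha, hE hs⟩

theorem Red.asc_val {n : ℕ} {s : Shape} {ε : Evd n} {G : GTy n} {v : Tm D n}
    (hG : G.ty.shape = s) (hv : GoodVal s v) : Red (GoodVal s) (.asc ε v G) := by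
  obtain ⟨ε', u, G', rfl, hε', hG', hu⟩ := hv
  cases ht : ε'.trans ε with
  | none => exact .inr ⟨_, .refl, .ascr_error hu.isSimple ht⟩
  | some ε'' =>
    exact .inl ⟨_, .single (.ascr hu.isSimple ht), _, _, _, rfl, hε'.trans ht, hG, hu⟩

theorem Red.asc {n : ℕ} {s : Shape} {ε : Evd n} {G : GTy n} {e : Tm D n}
    (hG : G.ty.shape = s) (he : Red (GoodVal s) e) : Red (GoodVal s) (.asc ε e G) :=
  he.bind (fun e => .asc ε e G) (fun h => .asc_body h) fun _ hv => .asc_val hG hv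

theorem Red.app_val {n : ℕ} {s t : Shape} {v w : Tm D n} (hv : GoodVal (.arr s t) v)
    (hw : GoodVal s w) : Red (GoodVal t) (.app v w) := by
  obtain ⟨ε, _, G, rfl, hε, hG, A, e, rfl, hA, -, h⟩ := hv
  obtain ⟨ε₁, u, G₁, rfl, hε₁, hG₁, hu⟩ := hw
  obtain ⟨εd, hd, -⟩ := hε.dom
  obtain ⟨εc, hc, -⟩ := hε.cod
  obtain ⟨C, hC, hCs⟩ := GTy.cod_of_shape hG
  cases ht : ε₁.trans εd with
  | none => exact .inr ⟨_, .refl, .app_error hu.isSimple hd ht⟩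
  | some ε' =>
    refine Red.step (.app hu.isSimple hd hc hC ht) (.asc hCs ?_)
    have := h n (DSub.id n) (.asc ε' u A) ⟨_, _, _, rfl, hε₁.trans ht, hA, hu⟩
    rwa [Tm.dsubst_id] at this

theorem Red.app {n : ℕ} {s t : Shape} {e₁ e₂ : Tm D n} (h₁ : Red (GoodVal (.arr s t)) e₁)
    (h₂ : Red (GoodVal s) e₂) : Red (GoodVal t) (.app e₁ e₂) :=
  h₁.bind (fun e => .app e e₂) (fun h => .app_fun h) fun v hv =>
    h₂.bind (fun e => .app v e) (fun h => .app_arg hv.isVal h) fun _ hw => .app_val hv hw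

theorem Red.inst {n : ℕ} {s : Shape} {e : Tm D n} (h : Red (GoodVal (.all s)) e) (Ξ : Env n) :
    Red (GoodVal s) (.inst e Ξ) := by
  refine h.bind (fun e => .inst e Ξ) (fun h => .inst_arg h) ?_
  rintro _ ⟨ε, _, G, rfl, hε, hG, v, rfl, hv⟩
  obtain ⟨εi, hi, -⟩ := hε.inst Ξ
  obtain ⟨C, hC, hCs⟩ := GTy.inst_of_shape hG Ξ
  exact .step (.inst hv.isVal hi hC) (.asc_val hCs (hv.dsubst _))

theorem Red.op {n : ℕ} (o : Op D) {args : Fin o.arity → Tm D n}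
    (h : ∀ j, Red (GoodVal (.base (o.dom j))) (args j)) :
    Red (GoodVal (.base o.cod)) (.op o args) := by
  -- Induction on the number `k` of arguments still to be evaluated; evaluation goes left to right,
  -- so these are the last `k`.
  suffices H : ∀ k, k ≤ o.arity → ∀ args : Fin o.arity → Tm D n,
      (∀ j : Fin o.arity, o.arity - k ≤ j → Red (GoodVal (.base (o.dom j))) (args j)) →
      (∀ j : Fin o.arity, (j : ℕ) < o.arity - k → GoodVal (.base (o.dom j)) (args j)) →
      Red (GoodVal (.base o.cod)) (.op o args) from
    H o.arity le_rfl args (fun j _ => h j) fun j hj => by omega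
  clear h args
  intro k
  induction k with
  | zero =>
    intro _ args _ hv
    have hv' : ∀ j, ∃ ε c G, args j = .asc ε (.const (o.dom j) c) G := fun j => by
      obtain ⟨ε, _, G, he, -, -, c, rfl⟩ := hv j (by simp)
      exact ⟨ε, c, G, he⟩
    choose ε c G he using hv'
    obtain rfl : args = _ := funext he
    exact .inl ⟨_, .single (.op o ε c G), _, _, _, rfl, ⟨rfl, rfl⟩, rfl, _, rfl⟩
  | succ k ih =>
    intro hk args hr hv
    let i : Fin o.arity := ⟨o.arity - (k + 1), by omega⟩
    -- Writing `args` as an update of itself exhibits the `i`-th argument as the hole of an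
    -- evaluation context.
    have key : Red (GoodVal (.base o.cod)) (.op o (Function.update args i (args i))) := by
      refine (hr i le_rfl).bind (fun e => .op o (Function.update args i e)) ?_ ?_
      · intro e r hs
        have := Step.op_arg o (Function.update args i e) i (r := r) (fun j hj => ?_) (by simpa)
        · simpa using this
        · rw [Function.update_of_ne hj.ne]
          exact (hv j hj).isVal
      · intro v hv'
        refine ih (by omega) _ (fun j hj => ?_) fun j hj => ?_
        · have hne : j ≠ i := fun h => by subst h; simp only [i] at hj; omega
          rw [Function.update_of_ne hne]
          exact hr j (by omega)
        · by_cases hji : j = i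
          · subst hji
            simpa using hv'
          · rw [Function.update_of_ne hji]
            refine hv j ?_
            have : (j : ℕ) ≠ o.arity - (k + 1) := fun h => hji (Fin.ext h)
            omega
    rwa [Function.update_eq_self] at key

/-- The fundamental lemma of the logical relation. -/
theorem Translates.red {n : ℕ} {Γ : List (GTy n)} {e : Src D n} {e' : Tm D n} {G : GTy n}
    (h : Translates Γ e e' G) : ∀ {m : ℕ} (σ : Fin n → Env m) (γ : ℕ → Tm D m),
      (∀ x, (γ x).Closed 0) → (∀ x H, Γ[x]? = some H → GoodVal H.ty.shape (γ x)) →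
      Red (GoodVal G.ty.shape) ((e'.dsubst σ).msubst 0 γ) := by
  induction h with
  | const b c hε =>
    intro m σ γ _ _
    exact .inl ⟨_, .refl, _, _, _, rfl, (GTy.interior_shape hε).2.subst σ, rfl, c, rfl⟩
  | op o _ hty ih =>
    intro m σ γ hc hγ
    exact .op o fun j => by
      have := ih j σ γ hc hγ
      rwa [hty j] at this
  | @var n Γ x G hx =>
    intro m σ γ hc hγ
    exact .inl ⟨_, .refl, hγ x G hx⟩
  | @lam n Γ G₁ G₂ e e' ε _ hε ih =>
    intro m σ γ hc hγ
    refine .inl ⟨_, .refl, _, _, _, rfl, (GTy.interior_shape hε).2.subst σ,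
      Ty.shape_subst _ _, _, _, rfl, Ty.shape_subst _ _, Tm.closed_msubst _ _ _ hc, ?_⟩
    intro l τ v hv
    -- The applied body is the original one under the composed distance substitution and the
    -- environment extended by `v`, which is an instance of the induction hypothesis.
    rw [Tm.msubst_dsubst, Tm.msubst_subst _ _ _ _ fun x => (hc x).dsubst τ, Tm.dsubst_comp]
    refine ih _ _ (fun x => ?_) fun x H hx => ?_
    · cases x with
      | zero => exact hv.closed
      | succ x => exact (hc x).dsubst τ
    · cases x with
      | zero =>
        simp only [List.getElem?_cons_zero, Option.some.injEq] at hx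
        subst hx
        exact hv
      | succ x => exact (hγ x H (by simpa using hx)).dsubst τ
  | @app n Γ G₁ G₂ A C e₁ e₂ e₁' e₂' ε _ _ hd hcod hε ih₁ ih₂ =>
    intro m σ γ hc hγ
    obtain ⟨g, Ξ⟩ := G₁
    cases g with
    | arr g₁ Ξ₁ g₂ Ξ₂ =>
      cases hd
      cases hcod
      have hs := (GTy.interior_shape hε).1
      refine Red.app (ih₁ σ γ hc hγ) (.asc (Ty.shape_subst _ _) ?_)
      rw [show g₁.shape = G₂.ty.shape from hs]
      exact ih₂ σ γ hc hγ
    | _ => cases hd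
  | @dlam n Γ G e e' ε _ hε ih =>
    intro m σ γ hc hγ
    have hε' := (GTy.interior_shape hε).2.subst σ
    refine (ih (DSub.lift σ) (fun x => (γ x).dsubst (DSub.shift m)) (fun x => (hc x).dsubst _)
      fun x H hx => ?_).bind (fun e => .asc _ (.dlam e) _) (fun h => .dlam_body h) fun v hv =>
        .inl ⟨_, .refl, _, _, _, rfl, hε', Ty.shape_subst _ _, v, rfl, hv⟩
    rw [List.getElem?_map, Option.map_eq_some_iff] at hx
    obtain ⟨H, hx, rfl⟩ := hx
    rw [show (H.subst (DSub.shift n)).ty.shape = H.ty.shape from Ty.shape_subst _ _]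
    exact (hγ x H hx).dsubst _
  | @inst n Γ G C e e' Ξ _ hC ih =>
    intro m σ γ hc hγ
    obtain ⟨g, Ξ'⟩ := G
    cases g with
    | all g Ξ₁ =>
      cases hC
      rw [show GTy.ty ⟨_, _⟩ = _ from rfl, Ty.shape_subst]
      exact (ih σ γ hc hγ).inst _
    | _ => cases hC
  | @ascr n Γ G G' e e' ε _ hε ih =>
    intro m σ γ hc hγ
    have hs := (GTy.interior_shape hε).1
    refine .asc (Ty.shape_subst _ _) ?_
    rw [hs]
    exact ih σ γ hc hγ

theorem Translates.closed {n : ℕ} {Γ : List (GTy n)} {e : Src D n} {e' : Tm D n} {G : GTy n}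
    (h : Translates Γ e e' G) : e'.Closed Γ.length := by
  induction h with
  | const b c hε => trivial
  | op o _ hty ih => exact ih
  | var hx => exact (List.getElem?_eq_some_iff.mp hx).1
  | lam _ _ ih => exact ih
  | app _ _ _ _ _ ih₁ ih₂ => exact ⟨ih₁, ih₂⟩
  | dlam _ _ ih => simpa [Tm.Closed] using ih
  | inst _ _ ih => exact ih
  | ascr _ _ ih => exact ih

/-- The value of a closed well-typed expression evaluates hereditarily. -/
theorem Translates.goodVal {n : ℕ} {e : Src D n} {e' v : Tm D n} {G : GTy n}
    (h : Translates [] e e' G) (hv : Evals e' (some v)) : GoodVal G.ty.shape v := by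
  -- The expression is closed, so the environment is irrelevant; any closed expression serves as its
  -- entries.
  have hr := h.red (DSub.id n) (fun _ => .const .bool true) (fun _ => trivial) (by simp)
  rw [Tm.dsubst_id, Tm.Closed.msubst_eq (k := 0) h.closed] at hr
  rcases hr with ⟨w, hw, hg⟩ | he
  · have hw' : Evals e' (some w) := ⟨hw, hg.isVal⟩
    cases hv.unique hw'
    exact hg
  · cases Evals.unique hv he

end Normalization

/-! ## Distances bounded by effects -/

/-- The lower bound of the distance that the effect `Ξ` allows, for distances `Δ` of the
inputs. -/
noncomputable def Env.lower {n : ℕ} (Ξ : Env n) (Δ : Fin n → ENNReal) : ENNReal :=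
  ∑ i, (Ξ i).fst * Δ i

theorem Env.lower_mono {n : ℕ} {Ξ Ξ' : Env n} (h : ∀ i, (Ξ i).fst ≤ (Ξ' i).fst)
    (Δ : Fin n → ENNReal) : Ξ.lower Δ ≤ Ξ'.lower Δ :=
  Finset.sum_le_sum fun i _ => mul_le_mul_left (h i) (Δ i)

theorem Env.lower_single {n : ℕ} (r : Fin n) (Δ : Fin n → ENNReal) :
    (Env.single r 1).lower Δ = Δ r := by
  simp [Env.lower, Env.single_fst]

/-- A distance substitution pulls distances back along itself: `shift` forgets the new distance,
`lift` keeps it, and `inst Ξ` sets it to `Ξ.lower Δ`, as the next three lemmas compute. -/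
theorem Env.lower_subst {m n : ℕ} (Ξ : Env m) (σ : Fin m → Env n) (Δ : Fin n → ENNReal) :
    (Ξ.subst σ).lower Δ = Ξ.lower fun j => (σ j).lower Δ := by
  simp only [Env.lower, Env.subst_fst, Finset.sum_mul, Finset.mul_sum]
  rw [Finset.sum_comm]
  simp only [mul_assoc]

theorem DSub.lower_shift {n : ℕ} (δ : ENNReal) (Δ : Fin n → ENNReal) :
    (fun j => (DSub.shift n j).lower (Fin.cons δ Δ : Fin (n + 1) → ENNReal)) = Δ := by
  funext j
  simp [DSub.shift, Env.lower_single]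

theorem DSub.lower_lift {m n : ℕ} (σ : Fin m → Env n) (δ : ENNReal) (Δ : Fin n → ENNReal) :
    (fun j => (DSub.lift σ j).lower (Fin.cons δ Δ : Fin (n + 1) → ENNReal)) =
      (Fin.cons δ fun j => (σ j).lower Δ) := by
  funext j
  refine Fin.cases ?_ (fun j => ?_) j
  · simp [DSub.lift, Env.lower_single]
  · simp only [DSub.lift, Fin.cons_succ]
    rw [Env.lower_subst, DSub.lower_shift]

theorem DSub.lower_inst {n : ℕ} (Ξ : Env n) (Δ : Fin n → ENNReal) :
    (fun j => (DSub.inst Ξ j).lower Δ) = (Fin.cons (Ξ.lower Δ) Δ : Fin (n + 1) → ENNReal) := by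
  funext j
  refine Fin.cases ?_ (fun j => ?_) j
  · simp [DSub.inst]
  · simp [DSub.inst, Env.lower_single]

theorem optPi_eq_some {n : ℕ} {α : Type} {f : Fin n → Option α} {p : Fin n → α} :
    optPi f = some p ↔ ∀ i, f i = some (p i) := by
  unfold optPi
  constructor
  · intro h i
    split_ifs at h with hf
    cases h
    simp
  · intro h
    rw [dif_pos fun i => by simp [h i]]
    simp [h]

/-- The only properties of composition that the sensitivity bound uses. Growth of the lower end
keeps existing bounds on constants valid; inheritance of the upper end from `ε₂` lets a final
ascription cap the result. -/
theorem Evd.trans_eff {n : ℕ} {ε₁ ε₂ ε : Evd n} (h : ε₁.trans ε₂ = some ε) (i : Fin n) :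
    (ε₁.snd.eff i).fst ≤ (ε.snd.eff i).fst ∧ (ε.snd.eff i).snd = (ε₂.snd.eff i).snd := by
  simp only [Evd.trans, Option.bind_eq_bind, Option.bind_eq_some_iff, Option.some.injEq,
    Env.trans, Option.map_eq_some_iff, optPi_eq_some] at h
  obtain ⟨t, -, _, ⟨p, hp, rfl⟩, rfl⟩ := h
  have := hp i
  unfold Sens.trans at this
  split_ifs at this with hs
  dsimp only
  rw [← Option.some.inj this]
  exact ⟨le_sup_left.trans le_sup_left, rfl⟩

section Simulation

variable {D : Type} [PseudoEMetricSpace D]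

/-! ## Expressions that differ in their constants only -/

/-- `ConstRel Δ e e'`: the expressions differ in constants only, and constants differ by no more than
the evidence of their ascription allows for the distances `Δ`. -/
inductive ConstRel : {n : ℕ} → (Fin n → ENNReal) → Tm D n → Tm D n → Prop
  | asc_const {n : ℕ} {Δ : Fin n → ENNReal} {b : Base} {c c' : b.Carrier D} {ε : Evd n}
      {G : GTy n} : b.dist c c' ≤ ε.snd.eff.lower Δ →
      ConstRel Δ (.asc ε (.const b c) G) (.asc ε (.const b c') G)
  | lam {n : ℕ} {Δ : Fin n → ENNReal} {G : GTy n} {e e' : Tm D n} :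
      ConstRel Δ e e' → ConstRel Δ (.lam G e) (.lam G e')
  | dlam {n : ℕ} {Δ : Fin n → ENNReal} {e e' : Tm D (n + 1)} :
      (∀ δ : ENNReal, ConstRel (Fin.cons δ Δ) e e') → ConstRel Δ (.dlam e) (.dlam e')
  | op {n : ℕ} {Δ : Fin n → ENNReal} {o : Op D} {a a' : Fin o.arity → Tm D n} :
      (∀ j, ConstRel Δ (a j) (a' j)) → ConstRel Δ (.op o a) (.op o a')
  | var {n : ℕ} {Δ : Fin n → ENNReal} {x : ℕ} : ConstRel Δ (.var x) (.var x)
  | app {n : ℕ} {Δ : Fin n → ENNReal} {e₁ e₁' e₂ e₂' : Tm D n} :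
      ConstRel Δ e₁ e₁' → ConstRel Δ e₂ e₂' → ConstRel Δ (.app e₁ e₂) (.app e₁' e₂')
  | inst {n : ℕ} {Δ : Fin n → ENNReal} {e e' : Tm D n} {Ξ : Env n} :
      ConstRel Δ e e' → ConstRel Δ (.inst e Ξ) (.inst e' Ξ)
  | asc {n : ℕ} {Δ : Fin n → ENNReal} {e e' : Tm D n} {ε : Evd n} {G : GTy n} :
      ConstRel Δ e e' → ConstRel Δ (.asc ε e G) (.asc ε e' G)

theorem ConstRel.dsubst {m : ℕ} {Δ : Fin m → ENNReal} {e e' : Tm D m} (h : ConstRel Δ e e') :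
    ∀ {n : ℕ} {Δ' : Fin n → ENNReal} (σ : Fin m → Env n), (fun j => (σ j).lower Δ') = Δ →
      ConstRel Δ' (e.dsubst σ) (e'.dsubst σ) := by
  induction h with
  | asc_const h =>
    rintro n Δ' σ rfl
    exact .asc_const (by simpa [Evd.subst, GTy.subst, Env.lower_subst] using h)
  | lam _ ih => intro n Δ' σ h; exact .lam (ih σ h)
  | dlam _ ih =>
    rintro n Δ' σ rfl
    exact .dlam fun δ => ih δ _ (DSub.lower_lift _ _ _)
  | op _ ih => intro n Δ' σ h; exact .op fun j => ih j σ h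
  | var => intros; exact .var
  | app _ _ ih₁ ih₂ => intro n Δ' σ h; exact .app (ih₁ σ h) (ih₂ σ h)
  | inst _ ih => intro n Δ' σ h; exact .inst (ih σ h)
  | asc _ ih => intro n Δ' σ h; exact .asc (ih σ h)

theorem ConstRel.subst {n : ℕ} {Δ : Fin n → ENNReal} {e e' : Tm D n} (h : ConstRel Δ e e') :
    ∀ {k : ℕ} {v v' : Tm D n}, ConstRel Δ v v' → ConstRel Δ (e.subst k v) (e'.subst k v') := by
  induction h with
  | asc_const h => intro k v v' hv; exact .asc_const h
  | lam _ ih => intro k v v' hv; exact .lam (ih hv)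
  | dlam _ ih =>
    intro k v v' hv
    exact .dlam fun δ => ih δ (hv.dsubst _ (DSub.lower_shift _ _))
  | op _ ih => intro k v v' hv; exact .op fun j => ih j hv
  | var =>
    intro k v v' hv
    simp only [Tm.subst]
    split_ifs
    · exact hv
    · exact .var
    · exact .var
  | app _ _ ih₁ ih₂ => intro k v v' hv; exact .app (ih₁ hv) (ih₂ hv)
  | inst _ ih => intro k v v' hv; exact .inst (ih hv)
  | asc _ ih => intro k v v' hv; exact .asc (ih hv)

theorem ConstRel.const_inv {n : ℕ} {Δ : Fin n → ENNReal} {b : Base} {c : b.Carrier D} {ε : Evd n}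
    {G : GTy n} {a : Tm D n} (h : ConstRel Δ (.asc ε (.const b c) G) a) :
    ∃ c', a = .asc ε (.const b c') G ∧ b.dist c c' ≤ ε.snd.eff.lower Δ := by
  cases h with
  | asc_const h => exact ⟨_, rfl, h⟩
  | asc h => cases h

/-- The last clause allows a change of evidence: a constant needs the new bound to be no smaller,
whereas functions and `Λ` carry no bound of their own. -/
theorem ConstRel.simple {n : ℕ} {u : Tm D n} (hu : u.IsSimple) :
    ∀ {Δ : Fin n → ENNReal} {ε : Evd n} {G : GTy n} {a : Tm D n}, ConstRel Δ (.asc ε u G) a →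
      ∃ u', a = .asc ε u' G ∧ u'.IsSimple ∧
        ∀ (ε' : Evd n) (G' : GTy n), ε.snd.eff.lower Δ ≤ ε'.snd.eff.lower Δ →
          ConstRel Δ (.asc ε' u G') (.asc ε' u' G') := by
  induction hu with
  | const b c =>
    intro Δ ε G a h
    cases h with
    | asc_const h => exact ⟨_, rfl, .const _ _, fun ε' G' hε => .asc_const (h.trans hε)⟩
    | asc h => cases h
  | lam A e =>
    intro Δ ε G a h
    cases h with
    | asc h =>
      cases h with
      | lam h => exact ⟨_, rfl, .lam _ _, fun ε' G' _ => .asc (.lam h)⟩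
  | dlam ε₀ u G₀ hu ih =>
    intro Δ ε G a h
    cases h with
    | asc h =>
      cases h with
      | dlam h =>
        -- The form of the body does not depend on the distance of the bound variable; `0` is an
        -- arbitrary choice.
        obtain ⟨u', rfl, hu', -⟩ := ih (h 0)
        exact ⟨_, rfl, .dlam _ _ _ hu', fun ε' G' _ => .asc (.dlam h)⟩

theorem ConstRel.isVal {n : ℕ} {v v' : Tm D n} {Δ : Fin n → ENNReal} (h : ConstRel Δ v v')
    (hv : v.IsVal) : v'.IsVal := by
  obtain ⟨ε, u, G, rfl, hu⟩ := hv
  obtain ⟨u', rfl, hu', -⟩ := ConstRel.simple hu h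
  exact ⟨_, _, _, rfl, hu'⟩

/-- The declared sensitivities bound the distance by a sum over arguments of bounds over variables;
exchanging the sums gives the effect of the result. -/
theorem Op.dist_le {n : ℕ} (o : Op D) {Δ : Fin n → ENNReal} {G : Fin o.arity → GTy n}
    {c c' : (j : Fin o.arity) → (o.dom j).Carrier D}
    (h : ∀ j, (o.dom j).dist (c j) (c' j) ≤ (G j).eff.lower Δ) :
    o.cod.dist (o.fn c) (o.fn c') ≤ (o.effect G).eff.lower Δ := by
  refine (o.sound c c').trans
    ((Finset.sum_le_sum fun j _ => mul_le_mul_right (h j) (o.sens j)).trans_eq ?_)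
  simp only [Env.lower, Op.effect, Sens.fst_sum, Sens.fst_mul, Finset.mul_sum, Finset.sum_mul]
  rw [Finset.sum_comm]
  simp only [mul_assoc]
  rfl

/-- Related results of a step. -/
inductive RelRes {n : ℕ} (Δ : Fin n → ENNReal) : Option (Tm D n) → Option (Tm D n) → Prop
  | some {e e' : Tm D n} : ConstRel Δ e e' → RelRes Δ (some e) (some e')
  | none : RelRes Δ none none

theorem RelRes.map {m n : ℕ} {Δ : Fin m → ENNReal} {Δ' : Fin n → ENNReal}
    {r r' : Option (Tm D m)} (h : RelRes Δ r r') {E E' : Tm D m → Tm D n}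
    (hE : ∀ {e e'}, ConstRel Δ e e' → ConstRel Δ' (E e) (E' e')) : RelRes Δ' (r.map E) (r'.map E') := by
  cases h with
  | some h => exact .some (hE h)
  | none => exact .none

/-- Related expressions reduce in lockstep. -/
theorem Step.simulation {n : ℕ} {e : Tm D n} {r : Option (Tm D n)} (h : Step e r) :
    ∀ {Δ : Fin n → ENNReal} {e' : Tm D n}, ConstRel Δ e e' → ∃ r', Step e' r' ∧ RelRes Δ r r' := by
  induction h with
  | op o ε c G =>
    intro Δ e' hr
    cases hr with
    | op hr =>
      choose c' he hc' using fun j => (hr j).const_inv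
      obtain rfl := funext he
      exact ⟨_, .op o ε c' G, .some (.asc_const (o.dist_le hc'))⟩
  | app hu hd hc hC ht =>
    intro Δ e' hr
    cases hr with
    | app h₁ h₂ =>
      obtain ⟨_, rfl, -, -⟩ := ConstRel.simple (.lam _ _) h₁
      obtain ⟨u', rfl, hu', hw⟩ := ConstRel.simple hu h₂
      cases h₁ with
      | asc h₁ =>
        cases h₁ with
        | lam h₁ =>
          refine ⟨_, .app hu' hd hc hC ht, .some (.asc (h₁.subst (hw _ _ ?_)))⟩
          exact Env.lower_mono (fun i => (Evd.trans_eff ht i).1) Δ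
  | app_error hu hd ht =>
    intro Δ e' hr
    cases hr with
    | app h₁ h₂ =>
      obtain ⟨u', rfl, hu', hw⟩ := ConstRel.simple hu h₂
      cases h₁ with
      | asc h₁ =>
        cases h₁ with
        | lam h₁ => exact ⟨_, .app_error hu' hd ht, .none⟩
  | inst hv hi hC =>
    intro Δ e' hr
    cases hr with
    | inst h =>
      cases h with
      | asc h =>
        cases h with
        | dlam h =>
          -- The bound variable receives the distance `Ξ.lower Δ`, one of those for which the bodies
          -- are related.
          exact ⟨_, .inst ((h 0).isVal hv) hi hC,
            .some (.asc ((h _).dsubst _ (DSub.lower_inst _ _)))⟩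
  | ascr hu ht =>
    intro Δ e' hr
    cases hr with
    | asc h =>
      obtain ⟨u', rfl, hu', hw⟩ := ConstRel.simple hu h
      exact ⟨_, .ascr hu' ht,
        .some (hw _ _ (Env.lower_mono (fun i => (Evd.trans_eff ht i).1) Δ))⟩
  | ascr_error hu ht =>
    intro Δ e' hr
    cases hr with
    | asc h =>
      obtain ⟨u', rfl, hu', hw⟩ := ConstRel.simple hu h
      exact ⟨_, .ascr_error hu' ht, .none⟩
  | op_arg o args i hv hs ih =>
    intro Δ e' hr
    cases hr with
    | op h =>
      obtain ⟨r', hs', hr'⟩ := ih (h i)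
      refine ⟨_, .op_arg o _ i (fun j hj => (h j).isVal (hv j hj)) hs', hr'.map fun he => ?_⟩
      refine .op fun j => ?_
      by_cases hj : j = i
      · subst hj
        simpa using he
      · simpa [hj] using h j
  | app_fun hs ih =>
    intro Δ e' hr
    cases hr with
    | app h₁ h₂ =>
      obtain ⟨r', hs', hr'⟩ := ih h₁
      exact ⟨_, .app_fun hs', hr'.map fun he => .app he h₂⟩
  | app_arg hv hs ih =>
    intro Δ e' hr
    cases hr with
    | app h₁ h₂ =>
      obtain ⟨r', hs', hr'⟩ := ih h₂
      exact ⟨_, .app_arg (h₁.isVal hv) hs', hr'.map fun he => .app h₁ he⟩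
  | inst_arg hs ih =>
    intro Δ e' hr
    cases hr with
    | inst h =>
      obtain ⟨r', hs', hr'⟩ := ih h
      exact ⟨_, .inst_arg hs', hr'.map fun he => .inst he⟩
  | dlam_body hs ih =>
    intro Δ e' hr
    cases hr with
    | asc h =>
      cases h with
      | dlam h =>
        obtain ⟨r', hs', hr'⟩ := ih (h 0)
        refine ⟨_, .dlam_body hs', ?_⟩
        -- The induction hypothesis gives a result for each `δ`; determinism shows that they all are
        -- `r'`.
        have hall : ∀ δ : ENNReal, RelRes (Fin.cons δ Δ) _ r' := fun δ => by
          obtain ⟨r'', hs'', hr''⟩ := ih (h δ)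
          rwa [hs'.deterministic hs'']
        cases hr' with
        | some _ => exact .some (.asc (.dlam fun δ => by cases hall δ; assumption))
        | none => exact .none
  | asc_body hs ih =>
    intro Δ e' hr
    cases hr with
    | asc h =>
      obtain ⟨r', hs', hr'⟩ := ih h
      exact ⟨_, .asc_body hs', hr'.map fun he => .asc he⟩
    | asc_const _ => exact absurd hs Step.not_const

theorem Steps.simulation {n : ℕ} {a b : Tm D n} (h : Steps a b) {Δ : Fin n → ENNReal}
    {a' : Tm D n} (hr : ConstRel Δ a a') : ∃ b', Steps a' b' ∧ ConstRel Δ b b' := by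
  induction h with
  | refl => exact ⟨_, .refl, hr⟩
  | tail _ hs ih =>
    obtain ⟨b', hb, hr'⟩ := ih
    obtain ⟨r', hs', hr''⟩ := hs.simulation hr'
    cases hr'' with
    | some h => exact ⟨_, hb.tail hs', h⟩

theorem Evals.simulation {n : ℕ} {a : Tm D n} {r : Option (Tm D n)} (h : Evals a r)
    {Δ : Fin n → ENNReal} {a' : Tm D n} (hr : ConstRel Δ a a') :
    ∃ r', Evals a' r' ∧ RelRes Δ r r' := by
  rcases r with _ | v
  · obtain ⟨b, hb, hs⟩ := h
    obtain ⟨b', hb', hr'⟩ := Steps.simulation hb hr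
    obtain ⟨r', hs', hr''⟩ := hs.simulation hr'
    cases hr''
    exact ⟨none, ⟨b', hb', hs'⟩, .none⟩
  · obtain ⟨b', hb', hr'⟩ := Steps.simulation h.1 hr
    exact ⟨some b', ⟨hb', hr'.isVal h.2⟩, .some hr'⟩

theorem Base.dist_self (b : Base) (c : b.Carrier D) : b.dist c c = 0 := by
  cases b <;> simp [Base.dist]

theorem Translates.rel {n : ℕ} {Γ : List (GTy n)} {e : Src D n} {e' : Tm D n} {G : GTy n}
    (h : Translates Γ e e' G) : ∀ Δ : Fin n → ENNReal, ConstRel Δ e' e' := by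
  induction h with
  | const b c hε => intro Δ; exact .asc_const (by simp [Base.dist_self])
  | op o _ hty ih => intro Δ; exact .op fun j => ih j Δ
  | var hx => intro Δ; exact .var
  | lam _ _ ih => intro Δ; exact .asc (.lam (ih Δ))
  | app _ _ _ _ _ ih₁ ih₂ => intro Δ; exact .app (ih₁ Δ) (.asc (ih₂ Δ))
  | dlam _ _ ih => intro Δ; exact .asc (.dlam fun δ => ih _)
  | inst _ _ ih => intro Δ; exact .inst (ih Δ)
  | ascr _ _ ih => intro Δ; exact .asc (ih Δ)

/-- Reflexivity is not automatic, as bare constants are unrelated. It holds for elaborated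
expressions, and the simulation transports it to their values. -/
theorem Translates.rel_of_evals {n : ℕ} {Γ : List (GTy n)} {e : Src D n} {e' v : Tm D n}
    {G : GTy n} (h : Translates Γ e e' G) (hv : Evals e' (some v)) (Δ : Fin n → ENNReal) :
    ConstRel Δ v v := by
  obtain ⟨r', he, hr⟩ := hv.simulation (h.rel Δ)
  cases hv.unique he
  cases hr
  assumption

/-- The upper ends of the outermost evidence's right effect are those of the outermost ascription
throughout a reduction. -/
theorem Steps.asc_upper {n : ℕ} {ε : Evd n} {e : Tm D n} {G : GTy n} {b : Tm D n}
    (h : Steps (.asc ε e G) b) : ∃ ε' e' G', b = .asc ε' e' G' ∧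
      ∀ i, (ε'.snd.eff i).snd = (ε.snd.eff i).snd := by
  induction h with
  | refl => exact ⟨_, _, _, rfl, fun _ => rfl⟩
  | tail _ hs ih =>
    obtain ⟨ε', e', G', rfl, hε⟩ := ih
    rcases hs.asc_inv with ⟨_, _, _, _, _, ⟨_, ht, hb⟩ | ⟨_, hb⟩⟩ | ⟨_, r₀, _, _, hb⟩ | ⟨r₀, _, hb⟩
    · cases hb
      exact ⟨_, _, _, rfl, fun i => (Evd.trans_eff ht i).2.trans (hε i)⟩
    · cases hb
    · rcases r₀ with _ | _ <;> cases hb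
      exact ⟨_, _, _, rfl, hε⟩
    · rcases r₀ with _ | _ <;> cases hb
      exact ⟨_, _, _, rfl, hε⟩

end Simulation

/-! ## The deterministic part of the mechanism -/

theorem Env.interior_eq_some {n : ℕ} {Ξ₁ Ξ₂ : Env n} {p : Env n × Env n}
    (h : Env.interior Ξ₁ Ξ₂ = some p) (i : Fin n) : (p.2 i).snd = (Ξ₂ i).snd := by
  simp only [Env.interior, Option.map_eq_some_iff, optPi_eq_some] at h
  obtain ⟨p, hp, rfl⟩ := h
  have := hp i
  unfold Sens.interior at this
  split_ifs at this with hs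
  dsimp only
  rw [← Option.some.inj this]

theorem Env.exists_interior {n : ℕ} {Ξ₁ Ξ₂ : Env n} (h : ∀ i, (Ξ₁ i).fst ≤ (Ξ₂ i).snd) :
    ∃ p, Env.interior Ξ₁ Ξ₂ = some p := by
  have : ∀ i, ∃ q, Sens.interior (Ξ₁ i) (Ξ₂ i) = some q := fun i => by
    unfold Sens.interior
    rw [dif_pos ⟨le_inf (Ξ₁ i).fst_le_snd (h i), sup_le (h i) (Ξ₂ i).fst_le_snd⟩]
    exact ⟨_, rfl⟩
  choose q hq using this
  exact ⟨_, by simp only [Env.interior, optPi_eq_some.mpr hq, Option.map_some]; rfl⟩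

theorem GTy.exists_interior_base {n : ℕ} (b : Base) {Ξ₁ Ξ₂ : Env n}
    (h : ∀ i, (Ξ₁ i).fst ≤ (Ξ₂ i).snd) :
    ∃ ε, GTy.interior ⟨.base b, Ξ₁⟩ ⟨.base b, Ξ₂⟩ = some ε := by
  obtain ⟨p, hp⟩ := Env.exists_interior h
  exact ⟨_, by simp [GTy.interior, Ty.interior, hp]; rfl⟩

theorem GTy.interior_upper {n : ℕ} {G₁ G₂ : GTy n} {ε : Evd n} (h : G₁.interior G₂ = some ε)
    (i : Fin n) : (ε.snd.eff i).snd = (G₂.eff i).snd := by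
  simp only [GTy.interior, Option.bind_eq_bind, Option.bind_eq_some_iff, Option.some.injEq] at h
  obtain ⟨t, -, e, he, rfl⟩ := h
  exact Env.interior_eq_some he i

section Call

variable {D : Type} [PseudoEMetricSpace D]

/-- The elaborated expression `f x :: Number[1 r]` with `x` bound to `c`. -/
def callTm {n : ℕ} (T : Base) (r : Fin n) (ε₁ ε₂ : Evd n) (f : Tm D n) (c : T.Carrier D) :
    Tm D n :=
  .asc ε₂ (.app f (.asc ε₁ (inputVal T r c) (inputTy T r))) (num1 r)

/-- Interiors are functions, so the elaboration of `f x :: Number[1 r]` is unique, and every call is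
the evaluation of one explicit expression in `f` and `c`. -/
theorem exists_callTm {n : ℕ} (T : Base) (r : Fin n) : ∃ ε₁ ε₂ : Evd n,
    (ε₂.snd.eff r).snd = 1 ∧
    ∀ (f : Tm D n) (c : T.Carrier D),
      (CallEvals T r f c none ↔ Evals (callTm T r ε₁ ε₂ f c) none) ∧
      ∀ q : ℝ, CallEvals T r f c (some q) ↔ ∃ ε G, Evals (callTm T r ε₁ ε₂ f c)
        (some (.asc ε (.const .real (show Base.real.Carrier D from q)) G)) := by
  obtain ⟨ε₁, h₁⟩ := GTy.exists_interior_base (n := n) T (Ξ₁ := Env.single r 1)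
    (Ξ₂ := Env.single r 1) fun i => NonemptyInterval.fst_le_snd _
  obtain ⟨ε₂, h₂⟩ := GTy.exists_interior_base (n := n) .real
    -- The effect of `f x` has lower end `0`, so the ascription is plausible statically and is
    -- checked only at run time.
    (Ξ₁ := Env.single r Sens.unknown + 0) (Ξ₂ := Env.single r 1) fun i => by
      have : ((Env.single r Sens.unknown + 0 : Env n) i).fst = 0 := by
        rw [add_zero, Env.single_fst]
        split_ifs <;> rfl
      rw [this]
      exact bot_le
  have htr : Translates [inputTy T r, queryTy T r] (checkedCall (D := D) r)
      (.asc ε₂ (.app (.var 1) (.asc ε₁ (.var 0) (inputTy T r))) (num1 r)) (num1 r) :=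
    .ascr (.app (.var rfl) (.var rfl) rfl rfl h₁) h₂
  have huniq : ∀ e', Translates [inputTy T r, queryTy T r] (checkedCall (D := D) r) e' (num1 r) →
      e' = .asc ε₂ (.app (.var 1) (.asc ε₁ (.var 0) (inputTy T r))) (num1 r) := by
    intro e' h
    cases h with
    | ascr h h₂' =>
      cases h with
      | app hv₁ hv₂ hd hc h₁' =>
        cases hv₁ with
        | var hx =>
          cases hv₂ with
          | var hy =>
            cases hx
            cases hy
            cases hd
            cases hc
            cases h₁.symm.trans h₁'
            cases h₂.symm.trans h₂'
            rfl
  have hs : ∀ (f : Tm D n) (c : T.Carrier D),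
      ((Tm.asc ε₂ (.app (.var 1) (.asc ε₁ (.var 0) (inputTy T r))) (num1 r)).subst 0
        (inputVal T r c)).subst 0 f = callTm T r ε₁ ε₂ f c := fun f c => by
    simp [Tm.subst, callTm, inputVal]
  refine ⟨ε₁, ε₂, ?_, fun f c => ⟨⟨?_, ?_⟩, fun q => ⟨?_, ?_⟩⟩⟩
  · rw [GTy.interior_upper h₂, Env.single_snd, if_pos rfl]
    rfl
  · rintro ⟨e', ht, he⟩
    rwa [huniq e' ht, hs] at he
  · intro he
    exact ⟨_, htr, by rwa [hs]⟩
  · rintro ⟨e', ε, G, ht, he⟩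
    rw [huniq e' ht, hs] at he
    exact ⟨ε, G, he⟩
  · rintro ⟨ε, G, he⟩
    exact ⟨_, ε, G, htr, by rwa [hs]⟩

theorem inputVal_good {n : ℕ} (T : Base) (r : Fin n) (c : T.Carrier D) :
    GoodVal (.base T) (inputVal T r c) :=
  ⟨_, _, _, rfl, ⟨rfl, rfl⟩, rfl, c, rfl⟩

/-- Calls on two inputs end alike, and their results differ by at most the distance of the
inputs. -/
theorem IsQuery.call {n : ℕ} {T : Base} {r : Fin n} {f : Tm D n} (hf : IsQuery T r f) :
    (∀ c, CallEvals T r f c none ∨ ∃ q, CallEvals T r f c (some q)) ∧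
    (∀ c q, ¬ (CallEvals T r f c none ∧ CallEvals T r f c (some q))) ∧
    (∀ c c', CallEvals T r f c none → CallEvals T r f c' none) ∧
    ∀ c c' q q', CallEvals T r f c (some q) → CallEvals T r f c' (some q') →
      edist q q' ≤ T.dist c c' := by
  obtain ⟨e, e', ht, hv⟩ := hf
  obtain ⟨ε₁, ε₂, hε₂, hcall⟩ := exists_callTm (D := D) T r
  -- All variables other than `r` get distance `0`, so that even an infinite sensitivity in them
  -- contributes nothing to the final bound.
  have hrel : ∀ c c' : T.Carrier D, ConstRel (Pi.single r (T.dist c c'))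
      (callTm T r ε₁ ε₂ f c) (callTm T r ε₁ ε₂ f c') := fun c c' =>
    .asc (.app (ht.rel_of_evals hv _) (.asc (.asc_const (by simp [inputTy, Env.lower_single]))))
  refine ⟨fun c => ?_, fun c q h => ?_, fun c c' h => ?_, fun c c' q q' h h' => ?_⟩
  · have hr : Red (GoodVal (.base .real)) (callTm T r ε₁ ε₂ f c) :=
      .asc rfl (.app (.inl ⟨f, .refl, ht.goodVal hv⟩) (.asc_val rfl (inputVal_good T r c)))
    rcases hr with ⟨v, hs, hg⟩ | he
    · have hval := hg.isVal
      obtain ⟨ε, _, G, rfl, -, -, q, rfl⟩ := hg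
      exact .inr ⟨q, ((hcall f c).2 q).mpr ⟨ε, G, hs, hval⟩⟩
    · exact .inl ((hcall f c).1.mpr he)
  · obtain ⟨ε, G, he⟩ := ((hcall f c).2 q).mp h.2
    cases ((hcall f c).1.mp h.1).unique he
  · obtain ⟨r', he, hr⟩ := ((hcall f c).1.mp h).simulation (hrel c c')
    cases hr
    exact (hcall f c').1.mpr he
  · obtain ⟨ε, G, he⟩ := ((hcall f c).2 q).mp h
    obtain ⟨ε', G', he'⟩ := ((hcall f c').2 q').mp h'
    obtain ⟨r', he'', hr⟩ := he.simulation (hrel c c')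
    cases he'.unique he''
    cases hr with
    | some hr =>
      obtain ⟨c'', ha, hd⟩ := hr.const_inv
      cases ha
      refine hd.trans ?_
      -- The upper end at `r` is still the `1` of the ascription, so the lower end there is at most
      -- `1`.
      obtain ⟨_, _, _, hb, hup⟩ := Steps.asc_upper he.1
      cases hb
      simp only [Env.lower]
      rw [Finset.sum_eq_single r (fun i _ hi => by simp [hi]) (by simp), Pi.single_eq_same]
      calc _ ≤ (1 : ENNReal) * T.dist c c' := by
            gcongr
            rw [← hε₂, ← hup r]
            exact NonemptyInterval.fst_le_snd _
        _ = _ := one_mul _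

/-- The call does not involve the noise, so the alternative and the function `q` are the same for
every `ε`; this serves both `ε` itself and the `ε / 4` of the threshold search. -/
theorem IsQuery.glm_cases {n : ℕ} {T : Base} {r : Fin n} {f : Tm D n} (hf : IsQuery T r f) :
    (∀ ε c, glm T r f ε c = Measure.dirac (Sum.inr ())) ∨
    ∃ q : T.Carrier D → ℝ, (∀ ε c, glm T r f ε c = (laplaceNoise (q c) 1 ε).map Sum.inl) ∧
      ∀ c c', edist (q c) (q c') ≤ T.dist c c' := by
  obtain ⟨htot, hex, herr, hdist⟩ := hf.call
  by_cases h : ∃ c, CallEvals T r f c none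
  · obtain ⟨c₀, hc₀⟩ := h
    refine .inl fun ε c => ?_
    have hc := herr c₀ c hc₀
    unfold glm
    rw [dif_neg (fun ⟨q, hq⟩ => hex c q ⟨hc, hq⟩), if_pos hc]
  · push Not at h
    have hq : ∀ c, ∃ q, CallEvals T r f c (some q) := fun c => (htot c).resolve_left (h c)
    refine .inr ⟨fun c => (hq c).choose, fun ε c => ?_, fun c c' =>
      hdist c c' _ _ (hq c).choose_spec (hq c').choose_spec⟩
    unfold glm
    rw [dif_pos (hq c)]

end Call

/-! ## The Laplace distribution -/

/-- Translation removes `μ`, symmetry folds the line onto the half-line, and an exponential integral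
is left. -/
theorem laplaceMeasure_univ (μ : ℝ) {b : ℝ} (hb : 0 < b) : laplaceMeasure μ b Set.univ = 1 := by
  have hint : ∫ y : ℝ, 1 / (2 * b) * Real.exp (-|y - μ| / b) = 1 := by
    rw [integral_const_mul,
      integral_sub_right_eq_self (fun y : ℝ => Real.exp (-|y| / b)) μ,
      integral_comp_abs (f := fun y : ℝ => Real.exp (-y / b))]
    have := integral_exp_mul_Ioi (a := -b⁻¹) (by simpa using hb) 0
    have hcongr : (fun y : ℝ => Real.exp (-y / b)) = fun y => Real.exp (-b⁻¹ * y) := by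
      funext y
      congr 1
      ring
    rw [hcongr, this]
    simp
    field_simp
  rw [laplaceMeasure, withDensity_apply _ MeasurableSet.univ, Measure.restrict_univ,
    ← ofReal_integral_eq_lintegral_ofReal (integrable_of_integral_eq_one hint)
      (ae_of_all _ fun y => by positivity), hint, ENNReal.ofReal_one]

theorem isProbabilityMeasure_laplaceMeasure (μ : ℝ) {b : ℝ} (hb : 0 < b) :
    IsProbabilityMeasure (laplaceMeasure μ b) := ⟨laplaceMeasure_univ μ hb⟩

theorem measurable_laplaceDensity (μ b : ℝ) :
    Measurable fun y : ℝ => ENNReal.ofReal (1 / (2 * b) * Real.exp (-|y - μ| / b)) := by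
  fun_prop

/-- Moving the mean by `d` changes probabilities by a factor of at most `exp (d / b)`. -/
theorem laplaceMeasure_le {μ μ' b d : ℝ} (hb : 0 < b) (h : |μ - μ'| ≤ d) :
    laplaceMeasure μ b ≤ ENNReal.ofReal (Real.exp (d / b)) • laplaceMeasure μ' b := by
  unfold laplaceMeasure
  rw [← withDensity_smul _ (measurable_laplaceDensity μ' b)]
  refine withDensity_mono (ae_of_all _ fun y => ?_)
  simp only [Pi.smul_apply, smul_eq_mul]
  rw [← ENNReal.ofReal_mul (Real.exp_nonneg _)]
  refine ENNReal.ofReal_le_ofReal ?_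
  rw [mul_left_comm, ← Real.exp_add, ← add_div]
  gcongr
  have := abs_sub_abs_le_abs_sub (y - μ') (y - μ)
  rw [show y - μ' - (y - μ) = μ - μ' by ring] at this
  linarith

theorem lintegral_laplaceMeasure_add (μ b a : ℝ) {h : ℝ → ENNReal} (hh : Measurable h) :
    ∫⁻ t, h (t + a) ∂laplaceMeasure μ b = ∫⁻ t, h t ∂laplaceMeasure (μ + a) b := by
  unfold laplaceMeasure
  rw [lintegral_withDensity_eq_lintegral_mul _ (measurable_laplaceDensity μ b) (by fun_prop),
    lintegral_withDensity_eq_lintegral_mul _ (measurable_laplaceDensity _ b) hh,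
    ← lintegral_add_right_eq_self
      ((fun y => ENNReal.ofReal (1 / (2 * b) * Real.exp (-|y - (μ + a)| / b))) * h) a]
  refine lintegral_congr fun t => ?_
  simp only [Pi.mul_apply]
  rw [show t + a - (μ + a) = t - μ by ring]

theorem laplaceMeasure_Ici_add (μ b a t : ℝ) :
    laplaceMeasure (μ + a) b (Set.Ici (t + a)) = laplaceMeasure μ b (Set.Ici t) := by
  have := lintegral_laplaceMeasure_add μ b a
    (measurable_one.indicator (measurableSet_Ici (a := t + a)) : Measurable
      ((Set.Ici (t + a)).indicator (1 : ℝ → ENNReal)))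
  rw [lintegral_indicator_one measurableSet_Ici] at this
  rw [← this, ← lintegral_indicator_one measurableSet_Ici]
  refine lintegral_congr fun s => ?_
  simp [Set.indicator_apply]

theorem laplaceMeasure_Iio (μ : ℝ) {b : ℝ} (hb : 0 < b) (t : ℝ) :
    laplaceMeasure μ b (Set.Iio t) = 1 - laplaceMeasure μ b (Set.Ici t) := by
  have := isProbabilityMeasure_laplaceMeasure μ hb
  rw [← prob_compl_eq_one_sub measurableSet_Ici, Set.compl_Ici]

/-- Raising the threshold by `1` outweighs any change of the mean by at most `1`. On complements
this says that staying below the threshold costs no privacy. -/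
theorem laplaceMeasure_Ici_le {q q' b : ℝ} (h : |q - q'| ≤ 1) (t : ℝ) :
    laplaceMeasure q' b (Set.Ici (t + 1)) ≤ laplaceMeasure q b (Set.Ici t) := by
  rw [← laplaceMeasure_Ici_add q' b (q - q') (t + 1), show q' + (q - q') = q by ring]
  refine measure_mono (Set.Ici_subset_Ici.mpr ?_)
  linarith [(abs_le.mp h).1]

theorem le_laplaceMeasure_Ici {q q' b : ℝ} (hb : 0 < b) (h : |q - q'| ≤ 1) (t : ℝ) :
    laplaceMeasure q b (Set.Ici t) ≤
      ENNReal.ofReal (Real.exp (2 / b)) * laplaceMeasure q' b (Set.Ici (t + 1)) := by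
  rw [← laplaceMeasure_Ici_add q b 1 t]
  -- Moving the threshold back by `1` turns the mean `q` into `q + 1`, which is within `2` of `q'`.
  refine laplaceMeasure_le hb (d := 2) ?_ _
  rw [abs_le] at h ⊢
  constructor <;> linarith [h.1, h.2]

theorem laplaceMeasure_Iio_le {q q' b : ℝ} (hb : 0 < b) (h : |q - q'| ≤ 1) (t : ℝ) :
    laplaceMeasure q b (Set.Iio t) ≤ laplaceMeasure q' b (Set.Iio (t + 1)) := by
  rw [laplaceMeasure_Iio q hb, laplaceMeasure_Iio q' hb]
  exact tsub_le_tsub_left (laplaceMeasure_Ici_le h t) 1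

/-! ## The Gradual Laplace Mechanism -/

section Privacy

variable {D : Type} [PseudoEMetricSpace D]

theorem abs_sub_le_one_of_edist {x y : ℝ} (h : edist x y ≤ 1) : |x - y| ≤ 1 := by
  rw [edist_dist, ← ENNReal.ofReal_one, ENNReal.ofReal_le_ofReal_iff zero_le_one] at h
  exact h

theorem diffPrivate_laplaceNoise {T : Base} {ε : ℝ} (hε : 0 < ε)
    {M : T.Carrier D → Measure (ℝ ⊕ Unit)} {q : T.Carrier D → ℝ} (hM : ∀ c, M c = (laplaceNoise (q c) 1 ε).map Sum.inl)
    (hq : ∀ c c', edist (q c) (q c') ≤ T.dist c c') : DiffPrivate T ε M := by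
  have hb : 0 < 1 / ε := by positivity
  refine ⟨fun c => ?_, fun c c' hcc S hS => ?_⟩
  · rw [hM]
    have : IsProbabilityMeasure (laplaceNoise (q c) 1 ε) :=
      isProbabilityMeasure_laplaceMeasure (q c) hb
    exact Measure.isProbabilityMeasure_map measurable_inl.aemeasurable
  · rw [hM, hM, Measure.map_apply measurable_inl hS, Measure.map_apply measurable_inl hS]
    have := laplaceMeasure_le hb (abs_sub_le_one_of_edist ((hq c c').trans hcc)) (Sum.inl ⁻¹' S)
    simpa [laplaceNoise] using this

theorem IsQuery.glm_private {n : ℕ} {T : Base} {r : Fin n} {f : Tm D n} (hf : IsQuery T r f)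
    {ε : ℝ} (hε : 0 < ε) :
    (∀ c : T.Carrier D, glm T r f ε c = Measure.dirac (Sum.inr ())) ∨
      ((∀ c : T.Carrier D, glm T r f ε c {Sum.inr ()} = 0) ∧ DiffPrivate T ε (glm T r f ε)) := by
  rcases hf.glm_cases with h | ⟨q, h, hq⟩
  · exact .inl (h ε)
  · refine .inr ⟨fun c => ?_, diffPrivate_laplaceNoise hε (h ε) hq⟩
    have hmeas : MeasurableSet ({Sum.inr ()} : Set (ℝ ⊕ Unit)) := by
      rw [← Set.image_singleton]
      exact measurableSet_inr_image.mpr (measurableSet_singleton _)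
    have hempty : (Sum.inl : ℝ → ℝ ⊕ Unit) ⁻¹' {Sum.inr ()} = ∅ := by
      ext
      simp
    rw [h, Measure.map_apply measurable_inl hmeas, hempty, measure_empty]

/-! ## The Gradual Above Threshold algorithm -/

theorem gatSearch_cons_error {n : ℕ} {T : Base} {r : Fin n} {f : Tm D n} {ε : ℝ}
    {c : T.Carrier D} (h : glm T r f (ε / 4) c = Measure.dirac (Sum.inr ())) (t : ℝ) (i : ℤ)
    (fs : List (Tm D n)) :
    gatSearch T r ε c t i (f :: fs) = gatSearch T r ε c t (i + 1) fs := by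
  rw [gatSearch, h, Measure.dirac_bind]
  refine measurable_fun_sum ?_ measurable_const
  exact Measurable.ite measurableSet_Ici measurable_const measurable_const

theorem gatSearch_cons_number {n : ℕ} {T : Base} {r : Fin n} {f : Tm D n} {ε q : ℝ}
    {c : T.Carrier D} (h : glm T r f (ε / 4) c = (laplaceNoise q 1 (ε / 4)).map Sum.inl)
    (t : ℝ) (i : ℤ) (fs : List (Tm D n)) (S : Set ℤ) :
    gatSearch T r ε c t i (f :: fs) S =
      laplaceMeasure q (1 / (ε / 4)) (Set.Ici t) * Measure.dirac i S +
        laplaceMeasure q (1 / (ε / 4)) (Set.Iio t) * gatSearch T r ε c t (i + 1) fs S := by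
  have hS : MeasurableSet S := .of_discrete
  have hite : Measurable fun y : ℝ => open Classical in
      if t ≤ y then Measure.dirac i else gatSearch T r ε c t (i + 1) fs :=
    Measurable.ite measurableSet_Ici measurable_const measurable_const
  rw [gatSearch, h, Measure.bind_apply hS, lintegral_map _ measurable_inl]
  · rw [← lintegral_add_compl _ (measurableSet_Ici (a := t)), Set.compl_Ici]
    unfold laplaceNoise
    congr 1
    · rw [setLIntegral_congr_fun (g := fun _ => Measure.dirac i S) measurableSet_Ici
        fun y hy => by simp only [if_pos (Set.mem_Ici.mp hy)], setLIntegral_const, mul_comm]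
    · rw [setLIntegral_congr_fun (g := fun _ => gatSearch T r ε c t (i + 1) fs S)
        measurableSet_Iio fun y hy => by
          simp only [if_neg (not_le.mpr (Set.mem_Iio.mp hy))], setLIntegral_const, mul_comm]
  · exact (Measure.measurable_coe hS).comp (measurable_fun_sum hite measurable_const)
  · exact (measurable_fun_sum hite measurable_const).aemeasurable

/-- Measurability in `t` comes from monotonicity of the two tail probabilities. -/
theorem measurable_gatSearch {n : ℕ} {T : Base} {r : Fin n} (ε : ℝ) (c : T.Carrier D)
    (fs : List (Tm D n)) (hfs : ∀ f ∈ fs, IsQuery T r f) :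
    ∀ i, Measurable fun t => gatSearch T r ε c t i fs := by
  induction fs with
  | nil => intro i; simp only [gatSearch]; exact measurable_const
  | cons f fs ih =>
    intro i
    have ih' := ih (fun g hg => hfs g (List.mem_cons_of_mem f hg)) (i + 1)
    rcases (hfs f List.mem_cons_self).glm_cases with h | ⟨q, h, -⟩
    · simpa only [gatSearch_cons_error (h _ c)] using ih'
    · refine Measure.measurable_of_measurable_coe _ fun S hS => ?_
      simp only [gatSearch_cons_number (h _ c)]
      have hIci : Measurable fun t => laplaceMeasure (q c) (1 / (ε / 4)) (Set.Ici t) :=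
        Antitone.measurable fun s t hst => measure_mono (Set.Ici_subset_Ici.mpr hst)
      have hIio : Measurable fun t => laplaceMeasure (q c) (1 / (ε / 4)) (Set.Iio t) :=
        Monotone.measurable fun s t hst => measure_mono (Set.Iio_subset_Iio hst)
      exact (hIci.mul_const _).add (hIio.mul ((Measure.measurable_coe hS).comp ih'))

theorem gatSearch_univ {n : ℕ} {T : Base} {r : Fin n} {ε : ℝ} (hε : 0 < ε) (c : T.Carrier D)
    (t : ℝ) (fs : List (Tm D n)) (hfs : ∀ f ∈ fs, IsQuery T r f) :
    ∀ i, gatSearch T r ε c t i fs Set.univ = 1 := by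
  induction fs with
  | nil => intro i; simp [gatSearch]
  | cons f fs ih =>
    intro i
    have ih' := ih (fun g hg => hfs g (List.mem_cons_of_mem f hg)) (i + 1)
    rcases (hfs f List.mem_cons_self).glm_cases with h | ⟨q, h, -⟩
    · rwa [gatSearch_cons_error (h _ c)]
    · have hb : 0 < 1 / (ε / 4) := by positivity
      have := isProbabilityMeasure_laplaceMeasure (q c) hb
      rw [gatSearch_cons_number (h _ c), ih', measure_univ, mul_one, mul_one,
        laplaceMeasure_Iio _ hb, add_tsub_cancel_of_le prob_le_one]

/-- The search from index `i` on returns no smaller index other than `-1`. -/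
theorem gatSearch_singleton_of_lt {n : ℕ} {T : Base} {r : Fin n} (ε : ℝ) (c : T.Carrier D)
    (t : ℝ) (fs : List (Tm D n)) (hfs : ∀ f ∈ fs, IsQuery T r f) {k : ℤ} (hk : 0 ≤ k) :
    ∀ i, k < i → gatSearch T r ε c t i fs {k} = 0 := by
  induction fs with
  | nil =>
    intro i hi
    have : (-1 : ℤ) ∉ ({k} : Set ℤ) := by simp; omega
    simp [gatSearch, this]
  | cons f fs ih =>
    intro i hi
    have ih' := ih (fun g hg => hfs g (List.mem_cons_of_mem f hg)) (i + 1) (by omega)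
    rcases (hfs f List.mem_cons_self).glm_cases with h | ⟨q, h, -⟩
    · rwa [gatSearch_cons_error (h _ c)]
    · have : i ∉ ({k} : Set ℤ) := by simp; omega
      simp [gatSearch_cons_number (h _ c), ih', this]

/-- Raising the threshold by `1` makes up for the change of the input, at the cost of the query
that succeeds. -/
theorem gatSearch_singleton_le {n : ℕ} {T : Base} {r : Fin n} {ε : ℝ} (hε : 0 < ε)
    {c c' : T.Carrier D} (hc : T.dist c c' ≤ 1) (t : ℝ) (k : ℤ) (fs : List (Tm D n))
    (hfs : ∀ f ∈ fs, IsQuery T r f) :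
    ∀ i, 0 ≤ i → gatSearch T r ε c t i fs {k} ≤
      ENNReal.ofReal (Real.exp (ε / 2)) * gatSearch T r ε c' (t + 1) i fs {k} := by
  have hone : 1 ≤ ENNReal.ofReal (Real.exp (ε / 2)) := by
    rw [ENNReal.one_le_ofReal]
    exact Real.one_le_exp (by positivity)
  induction fs with
  | nil =>
    intro i _
    simp only [gatSearch]
    exact le_mul_of_one_le_left (zero_le) hone
  | cons f fs ih =>
    intro i hi
    have hfs' := fun g hg => hfs g (List.mem_cons_of_mem f hg)
    have ih' := ih hfs' (i + 1) (by omega)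
    rcases (hfs f List.mem_cons_self).glm_cases with h | ⟨q, h, hq⟩
    -- A failing query fails on both inputs and is skipped without cost.
    · rwa [gatSearch_cons_error (h _ c), gatSearch_cons_error (h _ c')]
    · have hb : 0 < 1 / (ε / 4) := by positivity
      have hd := abs_sub_le_one_of_edist ((hq c c').trans hc)
      rw [gatSearch_cons_number (h _ c), gatSearch_cons_number (h _ c')]
      by_cases hik : i = k
      · subst hik
        rw [gatSearch_singleton_of_lt ε c t fs hfs' hi _ (by omega), mul_zero, add_zero]
        have := le_laplaceMeasure_Ici hb hd t
        -- The noise has scale `4 / ε`, and the relative shift of mean and threshold is at most `2`.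
        rw [show 2 / (1 / (ε / 4)) = ε / 2 by field_simp; norm_num] at this
        simp only [Measure.dirac_apply_of_mem (Set.mem_singleton i), mul_one]
        exact this.trans (mul_le_mul_right le_self_add _)
      · have : i ∉ ({k} : Set ℤ) := hik
        simp only [Measure.dirac_apply, Set.indicator_of_notMem this, mul_zero, zero_add]
        -- This query is passed over at no cost; the factor `exp (ε / 2)` comes from the rest of the
        -- search.
        calc _ ≤ laplaceMeasure (q c') (1 / (ε / 4)) (Set.Iio (t + 1)) *
              (ENNReal.ofReal (Real.exp (ε / 2)) *
                gatSearch T r ε c' (t + 1) (i + 1) fs {k}) :=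
              mul_le_mul' (laplaceMeasure_Iio_le hb hd t) ih'
          _ = _ := mul_left_comm _ _ _

theorem gat_private {n : ℕ} {T : Base} {r : Fin n} {ε : ℝ} (hε : 0 < ε) (fs : List (Tm D n))
    (thr : ℝ) (hfs : ∀ f ∈ fs, IsQuery T r f) : DiffPrivate T ε (gat T r fs thr ε) := by
  have hb : 0 < 1 / (ε / 2) := by positivity
  have hmeas := fun c => measurable_gatSearch ε c fs hfs 0
  have happly : ∀ c S, gat T r fs thr ε c S =
      ∫⁻ t, gatSearch T r ε c t 0 fs S ∂laplaceMeasure thr (1 / (ε / 2)) := fun c S =>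
    Measure.bind_apply .of_discrete (hmeas c).aemeasurable
  have hprob := isProbabilityMeasure_laplaceMeasure thr hb
  refine ⟨fun c => ⟨?_⟩, fun c c' hc S hS => ?_⟩
  · rw [happly]
    simp_rw [gatSearch_univ hε c _ fs hfs 0]
    rw [lintegral_one, measure_univ]
  · have hsingle : ∀ k : ℤ, gat T r fs thr ε c {k} ≤
        ENNReal.ofReal (Real.exp ε) * gat T r fs thr ε c' {k} := fun k => by
      have hk : Measurable fun t => gatSearch T r ε c' t 0 fs {k} :=
        (Measure.measurable_coe (measurableSet_singleton k)).comp (hmeas c')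
      rw [happly, happly]
      calc _ ≤ ∫⁻ t, ENNReal.ofReal (Real.exp (ε / 2)) * gatSearch T r ε c' (t + 1) 0 fs {k}
              ∂laplaceMeasure thr (1 / (ε / 2)) :=
            lintegral_mono fun t => gatSearch_singleton_le hε hc t k fs hfs 0 le_rfl
        _ = ENNReal.ofReal (Real.exp (ε / 2)) * ∫⁻ t, gatSearch T r ε c' t 0 fs {k}
              ∂laplaceMeasure (thr + 1) (1 / (ε / 2)) := by
            rw [lintegral_const_mul' _ _ ENNReal.ofReal_ne_top,
              lintegral_laplaceMeasure_add thr _ 1 hk]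
        _ ≤ ENNReal.ofReal (Real.exp (ε / 2)) * (ENNReal.ofReal (Real.exp (ε / 2)) *
              ∫⁻ t, gatSearch T r ε c' t 0 fs {k} ∂laplaceMeasure thr (1 / (ε / 2))) := by
            gcongr
            rw [← smul_eq_mul, ← lintegral_smul_measure]
            -- The threshold noise has scale `2 / ε`, so a shift by `1` costs the other `exp (ε /
            -- 2)`.
            have := laplaceMeasure_le hb (μ := thr + 1) (μ' := thr) (d := 1) (by simp)
            rw [one_div_one_div] at this
            exact lintegral_mono' this le_rfl
        _ = _ := by
            rw [← mul_assoc, ← ENNReal.ofReal_mul (Real.exp_nonneg _), ← Real.exp_add,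
              add_halves]
    -- The outcomes are integers, so the bounds on single outcomes add up to a bound on `S`.
    rw [← Measure.tsum_indicator_apply_singleton _ S hS,
      ← Measure.tsum_indicator_apply_singleton _ S hS, ← ENNReal.tsum_mul_left]
    refine ENNReal.tsum_le_tsum fun k => ?_
    by_cases hkS : k ∈ S
    · simpa [hkS] using hsingle k
    · simp [hkS]

end Privacy

theorem mainTheorem5 {D : Type} [PseudoEMetricSpace D] (T : Base) (n : ℕ) (r : Fin n)
    (ε : ℝ) (hε : 0 < ε) :
    (∀ f : Tm D n, IsQuery T r f →
      (∀ c : T.Carrier D, glm T r f ε c = MeasureTheory.Measure.dirac (Sum.inr ())) ∨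
      ((∀ c : T.Carrier D, glm T r f ε c {Sum.inr ()} = 0) ∧
        DiffPrivate T ε (glm T r f ε))) ∧
    (∀ (fs : List (Tm D n)) (thr : ℝ), (∀ f ∈ fs, IsQuery T r f) →
      DiffPrivate T ε (gat T r fs thr ε)) :=
  ⟨fun _ hf => hf.glm_private hε, fun fs thr hfs => gat_private hε fs thr hfs⟩
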